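/- Let $\Gamma$ be a finite connected simple graph with vertex set $X$, path-length distance $\partial$ and diameter $D$, and write $\Gamma_i(x)=\{y\in X : \partial(x,y)=i\}$. $\Gamma$ is distance-regular if for $0\le h,i,j\le D$ the number $p^h_{i,j}=|\Gamma_i(x)\cap\Gamma_j(y)|$ (an intersection number) is the same for all $x,y$ with $\partial(x,y)=h$. For a distance-regular $\Gamma$ let $A_i$ $(0\le i\le D)$ be the distance matrices and $A=A_1$. An ordering of the primitive idempotents is a basis $E_0,\dots,E_D$ of $\mathrm{Span}_{\mathbb R}\{A_0,\dots,A_D\}$ with $E_0=|X|^{-1}J$ (where $J$ is the all-ones matrix), $\sum_i E_i=I$, $E_i^t=E_i$, $E_iE_j=\delta_{i,j}E_i$. With $\circ$ the entrywise product, the Krein parameters are defined by $E_i\circ E_j=|X|^{-1}\sum_h q^h_{i,j}E_h$. The ordering is $Q$-polynomial if for all $0\le h,i,j\le D$: $q^h_{i,j}=0$ whenever one of $h,i,j$ exceeds the sum of the other two, and $q^h_{i,j}\ne 0$ whenever one of $h,i,j$ equals the sum of the other two. In that case $E=E_1$ is called a $Q$-polynomial primitive idempotent. For $x\in X$ let $\hat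 x\in\mathbb R^X$ be the corresponding standard basis vector, and for $u,v\in E\,\mathbb R^X$ let $u\star v=E(u\circ v)$ (the Norton product). The set $\{E\hat x : x\in X\}$ is Norton-balanced if for all $x,y\in X$ and $0\le i,j\le D$ $$\sum_{z\in\Gamma_i(x)\cap\Gamma_j(y)}E\hat z\in\mathrm{Span}\{E\hat x,\,E\hat y,\,E\hat x\star E\hat y\}.$$ $\Gamma$ is Norton-balanced if it has a $Q$-polynomial primitive idempotent $E$ such that $\{E\hat x : x\in X\}$ is Norton-balanced. The Shrikhande graph is the Cayley graph of $(\mathbb Z/4)^2$ with connection set $\{\pm(1,0),\pm(0,1),\pm(1,1)\}$. A Doob graph is a (finite) Cartesian product of graphs, each isomorphic to the Shrikhande graph or to $K_4$, at least one factor being isomorphic to the Shrikhande graph. The Hamming graph $H(D,4)$ has as vertices the $D$-tuples over a 4-element set, two being adjacent when they differ in exactly one coordinate. Theorem. Let $D\ge 3$. (1) Let $\Gamma$ be a Doob graph of diameter $D$. Then $\Gamma$ and $H(D,4)$ are distance-regular of diameter $D$ with the same intersection numbers. $\Gamma$ has a $Q$-polynomial ordering $E_0,\dots,E_D$ of its primitive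 idempotents with $AE_i=(3D-4i)E_i$ $(0\le i\le D)$, and for this ordering and $E=E_1$ the set $\{E\hat x : x\in X\}$ is not Norton-balanced. Moreover the graph $\Gamma$ is not Norton-balanced. (2) $H(D,4)$ has a $Q$-polynomial ordering $E_0,\dots,E_D$ of its primitive idempotents with $AE_i=(3D-4i)E_i$ $(0\le i\le D)$, and for this ordering and $E=E_1$ the set $\{E\hat x : x\in X\}$ is Norton-balanced. In particular the graph $H(D,4)$ is Norton-balanced. (3) Consequently, the Norton-balanced property is not determined by the intersection numbers: there is no property $P$ of families $(p^h_{i,j})$ such that every $Q$-polynomial distance-regular graph of diameter $D$ with intersection numbers $p=(p^h_{i,j})$ is Norton-balanced if and only if $P(p)$ holds. -/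

import Mathlib

open scoped Matrix

namespace DRG

section Graphs

/-- The Cartesian product of a family of graphs: two tuples are adjacent when they are adjacent in
one coordinate and equal in all the other coordinates. -/
def cartesianProduct {ι : Type*} {V : ι → Type*} (G : ∀ i, SimpleGraph (V i)) :
    SimpleGraph (∀ i, V i) where
  Adj x y := ∃ i, (G i).Adj (x i) (y i) ∧ ∀ j, j ≠ i → x j = y j
  symm := ⟨by
    rintro x y ⟨i, h, h'⟩
    exact ⟨i, h.symm, fun j hj => (h' j hj).symm⟩⟩
  loopless := ⟨by
    rintro x ⟨i, h, _⟩
    exact (G i).loopless.irrefl _ h⟩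

/-- The Shrikhande graph: the Cayley graph of `ℤ/4 × ℤ/4` with connection set
`{±(1,0), ±(0,1), ±(1,1)}`. -/
def shrikhande : SimpleGraph (ZMod 4 × ZMod 4) :=
  SimpleGraph.circulantGraph {(1, 0), (0, 1), (1, 1)}

/-- The Hamming graph `H(D,N)`. -/
def hamming (D N : ℕ) : SimpleGraph (Fin D → Fin N) where
  Adj x y := hammingDist x y = 1
  symm := ⟨fun x y h => by rwa [hammingDist_comm]⟩
  loopless := ⟨fun x h => by simp at h⟩

/-- A Doob graph: a Cartesian product of finitely many graphs, each isomorphic to the Shrikhande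
graph or to the complete graph `K₄`, at least one factor being isomorphic to the Shrikhande
graph. -/
def IsDoob {X : Type*} (Γ : SimpleGraph X) : Prop :=
  ∃ (r : ℕ) (V : Fin r → Type) (G : ∀ i, SimpleGraph (V i)),
    (∀ i, Nonempty (G i ≃g shrikhande) ∨ Nonempty (G i ≃g (⊤ : SimpleGraph (Fin 4)))) ∧
    (∃ i, Nonempty (G i ≃g shrikhande)) ∧
    Nonempty (Γ ≃g cartesianProduct G)

end Graphs

section DistanceRegular

variable {X : Type*} [Fintype X] [DecidableEq X]

/-- `sphere Γ i x` is the set `Γ_i(x)` of vertices at distance `i` from `x` (for connected `Γ`). -/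
noncomputable def sphere (Γ : SimpleGraph X) (i : ℕ) (x : X) : Finset X :=
  Finset.univ.filter fun z => Γ.dist x z = i

/-- `Γ` is a connected graph of diameter `D` that is distance-regular with intersection numbers
`p h i j = |Γ_i(x) ∩ Γ_j(y)|` for `∂(x,y) = h` and `h, i, j ≤ D`. -/
def HasIntersectionNumbers (Γ : SimpleGraph X) (D : ℕ) (p : ℕ → ℕ → ℕ → ℕ) : Prop :=
  Γ.Connected ∧ Γ.diam = D ∧
    ∀ h i j, h ≤ D → i ≤ D → j ≤ D → ∀ x y, Γ.dist x y = h →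
      (sphere Γ i x ∩ sphere Γ j y).card = p h i j

def IsDistanceRegular (Γ : SimpleGraph X) (D : ℕ) : Prop :=
  ∃ p, HasIntersectionNumbers Γ D p

/-- The `i`-th distance matrix `A_i`. -/
noncomputable def distMatrix (Γ : SimpleGraph X) (i : ℕ) : Matrix X X ℝ :=
  Matrix.of fun x y => if Γ.dist x y = i then 1 else 0

/-- The Bose-Mesner algebra, as the real span of `A_0, …, A_D`. -/
noncomputable def boseMesner (Γ : SimpleGraph X) (D : ℕ) : Submodule ℝ (Matrix X X ℝ) :=
  Submodule.span ℝ (Set.range fun i : Fin (D + 1) => distMatrix Γ i)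

/-- `E_0, …, E_D` is an ordering of the primitive idempotents of `Γ` (with `E_0` the trivial
one). -/
def IsPrimitiveIdempotents (Γ : SimpleGraph X) {D : ℕ} (E : Fin (D + 1) → Matrix X X ℝ) : Prop :=
  LinearIndependent ℝ E ∧ Submodule.span ℝ (Set.range E) = boseMesner Γ D ∧
    E 0 = (Fintype.card X : ℝ)⁻¹ • Matrix.of (fun _ _ => 1) ∧
    ∑ i, E i = 1 ∧ (∀ i, (E i)ᵀ = E i) ∧
    ∀ i j, E i * E j = if i = j then E i else 0

/-- `q h i j` are the Krein parameters `q^h_{i,j}` for the ordering `E`; the product `⊙` is the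
entrywise one. -/
def IsKrein {D : ℕ} (E : Fin (D + 1) → Matrix X X ℝ)
    (q : Fin (D + 1) → Fin (D + 1) → Fin (D + 1) → ℝ) : Prop :=
  ∀ i j, E i ⊙ E j = (Fintype.card X : ℝ)⁻¹ • ∑ h, q h i j • E h

/-- `E_0, …, E_D` is a `Q`-polynomial ordering of the primitive idempotents of the distance-regular
graph `Γ` of diameter `D`. -/
def IsQPolynomialOrdering (Γ : SimpleGraph X) {D : ℕ} (E : Fin (D + 1) → Matrix X X ℝ) : Prop :=
  IsDistanceRegular Γ D ∧ IsPrimitiveIdempotents Γ E ∧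
    ∃ q, IsKrein E q ∧ ∀ h i j : Fin (D + 1),
      (((i + j : ℕ) < h ∨ (h + j : ℕ) < i ∨ (h + i : ℕ) < j) → q h i j = 0) ∧
      (((h : ℕ) = i + j ∨ (i : ℕ) = h + j ∨ (j : ℕ) = h + i) → q h i j ≠ 0)

/-- `E` is a `Q`-polynomial primitive idempotent of `Γ`, that is, `E = E_1` for some
`Q`-polynomial ordering. -/
def IsQPolynomialIdempotent (Γ : SimpleGraph X) (D : ℕ) (E : Matrix X X ℝ) : Prop :=
  ∃ F : Fin (D + 1) → Matrix X X ℝ, IsQPolynomialOrdering Γ F ∧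
    ∃ i : Fin (D + 1), (i : ℕ) = 1 ∧ E = F i

/-- The basis vector `x̂`. -/
def hat (x : X) : X → ℝ := Pi.single x 1

/-- The Norton product `u ⋆ v = E (u ∘ v)`, where `∘` is the entrywise product. -/
def norton (E : Matrix X X ℝ) (u v : X → ℝ) : X → ℝ := E *ᵥ (u * v)

/-- The set `{E x̂ | x ∈ X}` is Norton-balanced. -/
def NortonBalancedSet (Γ : SimpleGraph X) (D : ℕ) (E : Matrix X X ℝ) : Prop :=
  ∀ (x y : X) (i j : ℕ), i ≤ D → j ≤ D →
    ∑ z ∈ sphere Γ i x ∩ sphere Γ j y, E *ᵥ hat z ∈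
      Submodule.span ℝ {E *ᵥ hat x, E *ᵥ hat y, norton E (E *ᵥ hat x) (E *ᵥ hat y)}

/-- The graph `Γ` (of diameter `D`) is Norton-balanced. -/
def IsNortonBalanced (Γ : SimpleGraph X) (D : ℕ) : Prop :=
  ∃ E, IsQPolynomialIdempotent Γ D E ∧ NortonBalancedSet Γ D E

/-- `E_0, …, E_D` is a `Q`-polynomial ordering of the primitive idempotents of `Γ` for which the
eigenvalue of the adjacency matrix on `E_i` is `3D - 4i`. -/
def IsStandardOrdering (Γ : SimpleGraph X) {D : ℕ} (E : Fin (D + 1) → Matrix X X ℝ) : Prop :=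
  IsQPolynomialOrdering Γ E ∧
    ∀ i, distMatrix Γ 1 * E i = (3 * (D : ℝ) - 4 * ((i : ℕ) : ℝ)) • E i

end DistanceRegular

end DRG

namespace DRG

section Distance

variable {V : Type*} {G : SimpleGraph V}

/-- A function that changes by at most one along edges, and that can be decreased along an edge
whenever it is positive, is the distance of a graph. -/
theorem connected_and_dist_eq [Nonempty V] (δ : V → V → ℕ) (h0 : ∀ x, δ x x = 0)
    (h1 : ∀ x y, δ x y = 0 → x = y) (hadj : ∀ x y z, G.Adj z y → δ x y ≤ δ x z + 1)
    (hdec : ∀ x y n, δ x y = n + 1 → ∃ z, G.Adj z y ∧ δ x z = n) :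
    G.Connected ∧ ∀ x y, G.dist x y = δ x y := by
  have hwalk : ∀ x n y, δ x y = n → ∃ p : G.Walk x y, p.length = n := by
    intro x n
    induction n with
    | zero => intro y hy; obtain rfl := h1 _ _ hy; exact ⟨.nil, rfl⟩
    | succ n ih =>
      intro y hy
      obtain ⟨z, hz, hxz⟩ := hdec x y n hy
      obtain ⟨p, hp⟩ := ih z hxz
      exact ⟨p.concat hz, by simp [hp]⟩
  have hle : ∀ n x y (p : G.Walk x y), p.length = n → δ x y ≤ n := by
    intro n
    induction n with
    | zero =>
      intro x y p hp
      obtain rfl := SimpleGraph.Walk.eq_of_length_eq_zero hp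
      simp [h0]
    | succ n ih =>
      intro x y p hp
      rw [← SimpleGraph.Walk.length_reverse] at hp
      generalize p.reverse = q at hp
      cases q with
      | nil => simp at hp
      | cons h q =>
        have := ih _ _ q.reverse (by simpa using hp)
        exact (hadj _ _ _ h.symm).trans (by omega)
  have hc : G.Connected :=
    ⟨fun x y => (hwalk x _ y rfl).elim fun p _ => ⟨p⟩⟩
  refine ⟨hc, fun x y => le_antisymm ?_ ?_⟩
  · obtain ⟨p, hp⟩ := hwalk x _ y rfl
    exact hp ▸ SimpleGraph.dist_le p
  · obtain ⟨p, hp⟩ := hc.exists_walk_length_eq_dist x y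
    exact hle _ _ _ p hp

theorem exists_adj_dist_eq (hG : G.Connected) {x y : V} {n : ℕ} (h : G.dist x y = n + 1) :
    ∃ z, G.Adj z y ∧ G.dist x z = n := by
  obtain ⟨p, hp⟩ := hG.exists_walk_length_eq_dist y x
  cases p with
  | nil => simp at h
  | @cons _ z _ hyz q =>
    refine ⟨z, hyz.symm, ?_⟩
    have h1 : G.dist z x ≤ q.length := SimpleGraph.dist_le q
    have h2 : G.dist x y ≤ G.dist x z + G.dist z y := hG.dist_triangle
    have h3 : G.dist z y = 1 := SimpleGraph.dist_eq_one_iff_adj.2 hyz.symm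
    rw [SimpleGraph.dist_comm] at hp
    rw [SimpleGraph.dist_comm] at h1
    simp only [SimpleGraph.Walk.length_cons] at hp
    omega

theorem dist_le_dist_add_one (hG : G.Connected) {x y z : V} (h : G.Adj z y) :
    G.dist x y ≤ G.dist x z + 1 := by
  have h2 : G.dist x y ≤ G.dist x z + G.dist z y := hG.dist_triangle
  rwa [SimpleGraph.dist_eq_one_iff_adj.2 h] at h2

theorem connected_and_dist_iso {W : Type*} {H : SimpleGraph W} (hH : H.Connected) (φ : G ≃g H) :
    G.Connected ∧ ∀ x y, G.dist x y = H.dist (φ x) (φ y) := by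
  have : Nonempty V := hH.nonempty.map φ.symm
  refine connected_and_dist_eq _ (by simp) (fun x y h => ?_) (fun x y z h => ?_)
    fun x y n h => ?_
  · exact φ.injective (hH.dist_eq_zero_iff.1 h)
  · exact dist_le_dist_add_one hH (φ.map_adj_iff.2 h)
  · obtain ⟨z, hz, hz'⟩ := exists_adj_dist_eq hH h
    refine ⟨φ.symm z, ?_, by simpa using hz'⟩
    rw [← φ.map_adj_iff]; simpa using hz

theorem connected_and_dist_cartesianProduct {ι : Type*} [Fintype ι] [DecidableEq ι]
    {V : ι → Type*} {G : ∀ i, SimpleGraph (V i)} (hG : ∀ i, (G i).Connected) :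
    (cartesianProduct G).Connected ∧
      ∀ x y : ∀ i, V i, (cartesianProduct G).dist x y = ∑ i, (G i).dist (x i) (y i) := by
  have : ∀ i, Nonempty (V i) := fun i => (hG i).nonempty
  refine connected_and_dist_eq (fun x y : ∀ i, V i => ∑ i, (G i).dist (x i) (y i)) (by simp)
    (fun x y h => ?_) (fun x y z h => ?_) fun x y n h => ?_
  · simp only [Finset.sum_eq_zero_iff, Finset.mem_univ, true_imp_iff] at h
    exact funext fun i => (hG i).dist_eq_zero_iff.1 (h i)
  · obtain ⟨i, hi, hj⟩ := h
    rw [← Finset.add_sum_erase _ _ (Finset.mem_univ i),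
      ← Finset.add_sum_erase (a := i) _ (fun i => (G i).dist (x i) (z i)) (Finset.mem_univ i),
      Finset.sum_congr rfl (g := fun i => (G i).dist (x i) (z i))
        (fun j hj' => by rw [hj j (Finset.ne_of_mem_erase hj')])]
    have := dist_le_dist_add_one (hG i) (x := x i) hi
    omega
  · obtain ⟨i, -, hi⟩ : ∃ i ∈ Finset.univ, (G i).dist (x i) (y i) ≠ 0 := by
      apply Finset.exists_ne_zero_of_sum_ne_zero; omega
    obtain ⟨m, hm⟩ := Nat.exists_eq_succ_of_ne_zero hi
    obtain ⟨a, ha, ha'⟩ := exists_adj_dist_eq (hG i) hm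
    refine ⟨Function.update y i a, ⟨i, by simpa using ha, fun j hj => by simp [hj]⟩, ?_⟩
    rw [← Finset.add_sum_erase _ _ (Finset.mem_univ i)] at h ⊢
    rw [Finset.sum_congr rfl (g := fun i => (G i).dist (x i) (y i))
        (fun j hj' => by rw [Function.update_of_ne (Finset.ne_of_mem_erase hj')])]
    simp only [Function.update_self]
    omega

end Distance

section HammingLike

/-- A connected graph with the distance counts of the Hamming graph `H(D,4)`, expressed by
generating functions. -/
structure IsHammingLike {X : Type*} [Fintype X] (Γ : SimpleGraph X) (D : ℕ) : Prop where
  connected : Γ.Connected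
  dist_le : ∀ x y, Γ.dist x y ≤ D
  sum_pow : ∀ (x y : X) (a s b t : ℝ),
    ∑ z, (a ^ (D - Γ.dist x z) * s ^ Γ.dist x z) * (b ^ (D - Γ.dist z y) * t ^ Γ.dist z y) =
      (a * b + 3 * (s * t)) ^ (D - Γ.dist x y) * (a * t + s * b + 2 * (s * t)) ^ Γ.dist x y

theorem IsHammingLike.of_iso {V W : Type*} [Fintype V] [Fintype W] {G : SimpleGraph V}
    {H : SimpleGraph W} {D : ℕ} (hH : IsHammingLike H D) (φ : G ≃g H) : IsHammingLike G D := by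
  obtain ⟨hc, hd⟩ := connected_and_dist_iso hH.connected φ
  refine ⟨hc, fun x y => hd x y ▸ hH.dist_le _ _, fun x y a s b t => ?_⟩
  simp only [hd]
  rw [← hH.sum_pow]
  exact Equiv.sum_comp φ.toEquiv (fun z => (a ^ (D - H.dist (φ x) z) * s ^ H.dist (φ x) z) *
    (b ^ (D - H.dist z (φ y)) * t ^ H.dist z (φ y)))

theorem prod_pow_sub_mul_pow {ι : Type*} [Fintype ι] (w d : ι → ℕ) (h : ∀ i, d i ≤ w i)
    (a s : ℝ) :
    ∏ i, (a ^ (w i - d i) * s ^ d i) = a ^ (∑ i, w i - ∑ i, d i) * s ^ ∑ i, d i := by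
  rw [Finset.prod_mul_distrib, Finset.prod_pow_eq_pow_sum, Finset.prod_pow_eq_pow_sum,
    Finset.sum_tsub_distrib _ fun i _ => h i]

theorem IsHammingLike.cartesianProduct {ι : Type*} [Fintype ι] [DecidableEq ι]
    {V : ι → Type*} [∀ i, Fintype (V i)] {G : ∀ i, SimpleGraph (V i)} {w : ι → ℕ}
    (hG : ∀ i, IsHammingLike (G i) (w i)) :
    IsHammingLike (DRG.cartesianProduct G) (∑ i, w i) := by
  obtain ⟨hc, hd⟩ := connected_and_dist_cartesianProduct fun i => (hG i).connected
  refine ⟨hc, fun x y => ?_, fun x y a s b t => ?_⟩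
  · rw [hd]; exact Finset.sum_le_sum fun i _ => (hG i).dist_le _ _
  · simp only [hd, ← prod_pow_sub_mul_pow w _ fun i => (hG i).dist_le _ _,
      ← Finset.prod_mul_distrib, ← (hG _).sum_pow]
    rw [Finset.prod_univ_sum, Fintype.piFinset_univ]

theorem isHammingLike_top : IsHammingLike (⊤ : SimpleGraph (Fin 4)) 1 := by
  refine ⟨SimpleGraph.connected_top, fun x y => ?_, fun x y a s b t => ?_⟩
  · rw [SimpleGraph.dist_top]; split_ifs <;> simp
  · simp only [SimpleGraph.dist_top]
    fin_cases x <;> fin_cases y <;> simp [Fin.sum_univ_four] <;> ring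

/-- The distance from the zero vertex in the Shrikhande graph. -/
def shrikhandeWeight (v : ZMod 4 × ZMod 4) : ℕ :=
  if v = 0 then 0
  else if v ∈ [(1, 0), (3, 0), (0, 1), (0, 3), (1, 1), (3, 3)] then 1 else 2

theorem shrikhande_adj_iff (x y : ZMod 4 × ZMod 4) :
    shrikhande.Adj x y ↔ shrikhandeWeight (y - x) = 1 := by
  have h : ∀ v : ZMod 4 × ZMod 4, (v ≠ 0 ∧ ((-v = (1, 0) ∨ -v = (0, 1) ∨ -v = (1, 1)) ∨
      (v = (1, 0) ∨ v = (0, 1) ∨ v = (1, 1)))) ↔ shrikhandeWeight v = 1 := by decide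
  rw [← h, neg_sub, sub_ne_zero, ne_comm]
  simp [shrikhande, SimpleGraph.circulantGraph_adj]

theorem shrikhande_connected_and_dist :
    shrikhande.Connected ∧ ∀ x y, shrikhande.dist x y = shrikhandeWeight (y - x) := by
  have h1 : ∀ v, shrikhandeWeight v = 0 → v = 0 := by decide
  have h2 : ∀ v u, shrikhandeWeight u = 1 →
      shrikhandeWeight v ≤ shrikhandeWeight (v - u) + 1 := by decide
  have h3 : ∀ v, shrikhandeWeight v ≠ 0 →
      ∃ u, shrikhandeWeight u = 1 ∧ shrikhandeWeight (v - u) = shrikhandeWeight v - 1 := by decide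
  refine connected_and_dist_eq _ (by simp [shrikhandeWeight])
    (fun x y h => (sub_eq_zero.1 (h1 _ h)).symm) (fun x y z h => ?_) fun x y n h => ?_
  · have := h2 (y - x) _ ((shrikhande_adj_iff z y).1 h)
    rwa [show y - x - (y - z) = z - x by abel] at this
  · obtain ⟨u, hu, hu'⟩ := h3 (y - x) (by omega)
    refine ⟨y - u, (shrikhande_adj_iff _ _).2 (by simpa using hu), ?_⟩
    rw [show y - u - x = y - x - u by abel, hu', h]; rfl

theorem sum_eq_sum_card_mul {α : Type*} (S : Finset α) (D : ℕ) (d e : α → ℕ)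
    (hd : ∀ z, d z ≤ D) (he : ∀ z, e z ≤ D) (F : ℕ → ℕ → ℝ) :
    ∑ z ∈ S, F (d z) (e z) = ∑ i ∈ Finset.range (D + 1), ∑ j ∈ Finset.range (D + 1),
      ((S.filter fun z => d z = i ∧ e z = j).card : ℝ) * F i j := by
  have h : ∀ z, F (d z) (e z) = ∑ i ∈ Finset.range (D + 1), ∑ j ∈ Finset.range (D + 1),
      if d z = i ∧ e z = j then F i j else 0 := by
    intro z
    simp [ite_and, hd z, he z]
  simp_rw [h]
  rw [Finset.sum_comm]
  refine Finset.sum_congr rfl fun i _ => ?_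
  rw [Finset.sum_comm]
  refine Finset.sum_congr rfl fun j _ => ?_
  rw [← Finset.sum_filter, Finset.sum_const, nsmul_eq_mul]

theorem isHammingLike_shrikhande : IsHammingLike shrikhande 2 := by
  obtain ⟨hc, hd⟩ := shrikhande_connected_and_dist
  have hw : ∀ v, shrikhandeWeight v ≤ 2 := by decide
  have hcard : ∀ v : ZMod 4 × ZMod 4, ∀ i ∈ Finset.range 3, ∀ j ∈ Finset.range 3,
      (Finset.univ.filter fun z => shrikhandeWeight z = i ∧ shrikhandeWeight (v - z) = j).card =
        ((([[[1, 0, 0], [0, 6, 0], [0, 0, 9]], [[0, 1, 0], [1, 2, 3], [0, 3, 6]],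
          [[0, 0, 1], [0, 2, 4], [1, 4, 4]]] : List (List (List ℕ))).getD
            (shrikhandeWeight v) []).getD i []).getD j 0 := by
    decide
  refine ⟨hc, fun x y => hd x y ▸ hw _, fun x y a s b t => ?_⟩
  simp only [hd]
  rw [← Equiv.sum_comp (Equiv.addLeft x)]
  simp only [Equiv.coe_addLeft, add_sub_cancel_left, ← sub_sub]
  generalize y - x = v
  rw [sum_eq_sum_card_mul _ 2 shrikhandeWeight (fun z => shrikhandeWeight (v - z)) hw
    (fun z => hw _) (fun i j => (a ^ (2 - i) * s ^ i) * (b ^ (2 - j) * t ^ j)),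
    Finset.sum_congr rfl fun i hi => Finset.sum_congr rfl fun j hj => by
      rw [hcard v i hi j hj]]
  have h3 : shrikhandeWeight v = 0 ∨ shrikhandeWeight v = 1 ∨ shrikhandeWeight v = 2 := by
    have := hw v; omega
  rcases h3 with h | h | h <;> rw [h] <;> simp [Finset.sum_range_succ] <;> ring

theorem hamming_eq_cartesianProduct (D N : ℕ) :
    hamming D N = cartesianProduct fun _ : Fin D => (⊤ : SimpleGraph (Fin N)) := by
  ext x y
  simp only [hamming, hammingDist, cartesianProduct, Finset.card_eq_one, SimpleGraph.top_adj]
  refine exists_congr fun i => ?_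
  simp only [Finset.ext_iff, Finset.mem_filter, Finset.mem_univ, true_and, Finset.mem_singleton]
  refine ⟨fun h => ⟨(h i).2 rfl, fun j hj => ?_⟩, fun h j => ⟨fun hj => ?_, ?_⟩⟩
  · exact not_not.1 fun h' => hj ((h j).1 h')
  · exact not_not.1 fun h' => hj (h.2 j h')
  · rintro rfl; exact h.1

theorem isHammingLike_hamming (D : ℕ) : IsHammingLike (hamming D 4) D := by
  rw [hamming_eq_cartesianProduct]
  simpa using IsHammingLike.cartesianProduct fun _ : Fin D => isHammingLike_top

theorem hamming_dist (D : ℕ) (x y : Fin D → Fin 4) : (hamming D 4).dist x y = hammingDist x y := by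
  rw [hamming_eq_cartesianProduct, (connected_and_dist_cartesianProduct fun _ =>
    isHammingLike_top.connected).2]
  simp [SimpleGraph.dist_top, hammingDist, Finset.sum_ite]

end HammingLike

section Coefficients

theorem coeff_eq_of_forall_pos {n : ℕ} {c c' : ℕ → ℝ}
    (h : ∀ r : ℝ, 0 < r →
      ∑ i ∈ Finset.range n, c i * r ^ i = ∑ i ∈ Finset.range n, c' i * r ^ i) :
    ∀ i ∈ Finset.range n, c i = c' i := by
  have key : ∑ i ∈ Finset.range n, Polynomial.C (c i) * Polynomial.X ^ i =
      ∑ i ∈ Finset.range n, Polynomial.C (c' i) * Polynomial.X ^ i := by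
    refine Polynomial.eq_of_infinite_eval_eq _ _ ((Set.Ioi_infinite (0 : ℝ)).mono fun r hr => ?_)
    simpa [Polynomial.eval_finsetSum] using h r hr
  intro i hi
  have := congrArg (Polynomial.coeff · i) key
  simpa [Polynomial.finsetSum_coeff, Polynomial.coeff_C_mul, Polynomial.coeff_X_pow,
    Finset.mem_range.1 hi] using this

theorem coeff_eq_of_forall_pos₂ {n : ℕ} {c c' : ℕ → ℕ → ℝ}
    (h : ∀ r u : ℝ, 0 < r → 0 < u →
      ∑ i ∈ Finset.range n, ∑ j ∈ Finset.range n, c i j * (r ^ i * u ^ j) =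
        ∑ i ∈ Finset.range n, ∑ j ∈ Finset.range n, c' i j * (r ^ i * u ^ j)) :
    ∀ i ∈ Finset.range n, ∀ j ∈ Finset.range n, c i j = c' i j := by
  intro i hi
  apply coeff_eq_of_forall_pos
  intro u hu
  refine coeff_eq_of_forall_pos (c := fun i => ∑ j ∈ Finset.range n, c i j * u ^ j)
    (c' := fun i => ∑ j ∈ Finset.range n, c' i j * u ^ j) (fun r hr => ?_) i hi
  simpa only [Finset.sum_mul, mul_assoc, mul_comm (u ^ _)] using h r u hr hu

end Coefficients

section IntersectionNumbers

/-- The vertex of `H(D,4)` whose first `h` coordinates are equal to one and whose other coordinates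
are equal to zero. -/
def initialVertex (D h : ℕ) : Fin D → Fin 4 := fun c => if (c : ℕ) < h then 1 else 0

/-- The intersection numbers of `H(D,4)`. -/
def hammingNumber (D h i j : ℕ) : ℕ :=
  (Finset.univ.filter fun z : Fin D → Fin 4 =>
    hammingDist 0 z = i ∧ hammingDist z (initialVertex D h) = j).card

theorem card_filter_coe_lt {D h : ℕ} (hD : h ≤ D) :
    (Finset.univ.filter fun c : Fin D => (c : ℕ) < h).card = h := by
  rw [← Fintype.card_subtype]
  conv_rhs => rw [← Fintype.card_fin h]
  exact Fintype.card_congr ⟨fun c => ⟨c.1, c.2⟩, fun c => ⟨⟨c, c.2.trans_le hD⟩, c.2⟩,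
    fun _ => rfl, fun _ => rfl⟩

theorem hammingDist_initialVertex {D h : ℕ} (hD : h ≤ D) :
    hammingDist 0 (initialVertex D h) = h := by
  conv_rhs => rw [← card_filter_coe_lt hD]
  unfold hammingDist initialVertex
  congr 1; ext c; by_cases hc : (c : ℕ) < h <;> simp [hc]

variable {X : Type*} [Fintype X] {Γ : SimpleGraph X} {D : ℕ}

theorem IsHammingLike.sum_card_mul_pow (hΓ : IsHammingLike Γ D) (x y : X) (r u : ℝ) :
    ∑ i ∈ Finset.range (D + 1), ∑ j ∈ Finset.range (D + 1),
      ((Finset.univ.filter fun z => Γ.dist x z = i ∧ Γ.dist z y = j).card : ℝ) *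
        (r ^ i * u ^ j) =
      (1 + 3 * (r * u)) ^ (D - Γ.dist x y) * (r + u + 2 * (r * u)) ^ Γ.dist x y := by
  have := hΓ.sum_pow x y 1 r 1 u
  simp only [one_pow, one_mul, mul_one] at this
  rw [← sum_eq_sum_card_mul _ D _ _ (hΓ.dist_le x) (fun z => hΓ.dist_le z y)
    (fun i j => r ^ i * u ^ j), this, add_comm u r]

theorem sum_hammingNumber_mul_pow {h : ℕ} (hD : h ≤ D) (r u : ℝ) :
    ∑ i ∈ Finset.range (D + 1), ∑ j ∈ Finset.range (D + 1),
      (hammingNumber D h i j : ℝ) * (r ^ i * u ^ j) =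
      (1 + 3 * (r * u)) ^ (D - h) * (r + u + 2 * (r * u)) ^ h := by
  have := (isHammingLike_hamming D).sum_card_mul_pow 0 (initialVertex D h) r u
  simp only [hamming_dist, hammingDist_initialVertex hD] at this
  rw [← this]
  unfold hammingNumber
  congr! 6

theorem IsHammingLike.card_eq_hammingNumber (hΓ : IsHammingLike Γ D) {i j : ℕ} (hi : i ≤ D)
    (hj : j ≤ D) (x y : X) :
    (Finset.univ.filter fun z => Γ.dist x z = i ∧ Γ.dist z y = j).card =
      hammingNumber D (Γ.dist x y) i j := by
  have := coeff_eq_of_forall_pos₂ (n := D + 1)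
    (c := fun i j => ((Finset.univ.filter fun z => Γ.dist x z = i ∧ Γ.dist z y = j).card : ℝ))
    (c' := fun i j => (hammingNumber D (Γ.dist x y) i j : ℝ))
    (fun r u _ _ => by
      rw [hΓ.sum_card_mul_pow, sum_hammingNumber_mul_pow (hΓ.dist_le x y)])
    i (by simp; omega) j (by simp; omega)
  exact_mod_cast this

theorem exists_of_hammingNumber_ne_zero {h i j : ℕ} (hp : hammingNumber D h i j ≠ 0) :
    ∃ z : Fin D → Fin 4, hammingDist 0 z = i ∧ hammingDist z (initialVertex D h) = j := by
  obtain ⟨z, hz⟩ := Finset.card_ne_zero.1 hp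
  exact ⟨z, (Finset.mem_filter.1 hz).2⟩

theorem hammingNumber_ne_zero {h i j : ℕ} (hi : i ≤ D) (hj : j ≤ D) (x y z : Fin D → Fin 4)
    (hh : hammingDist x y = h) (hxz : hammingDist x z = i) (hzy : hammingDist z y = j) :
    hammingNumber D h i j ≠ 0 := by
  rw [← hh, ← hamming_dist, ← (isHammingLike_hamming D).card_eq_hammingNumber hi hj,
    Finset.card_ne_zero]
  exact ⟨z, by simp [hamming_dist, hxz, hzy]⟩

theorem hammingNumber_eq_zero {h i j : ℕ} (hD : h ≤ D) (hij : i + j < h ∨ h + j < i ∨ h + i < j) :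
    hammingNumber D h i j = 0 := by
  by_contra hp
  obtain ⟨z, hz, hz'⟩ := exists_of_hammingNumber_ne_zero hp
  have h0 := hammingDist_initialVertex hD
  have h1 := hammingDist_triangle 0 z (initialVertex D h)
  have h2 := hammingDist_triangle 0 (initialVertex D h) z
  have h3 := hammingDist_triangle z 0 (initialVertex D h)
  rw [hammingDist_comm (initialVertex D h) z] at h2
  rw [hammingDist_comm z 0] at h3
  omega

theorem hammingDist_initialVertex_initialVertex {i h : ℕ} (hi : i ≤ h) (hD : h ≤ D) :
    hammingDist (initialVertex D i) (initialVertex D h) = h - i := by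
  have : hammingDist (initialVertex D i) (initialVertex D h) =
      ((Finset.univ.filter fun c : Fin D => (c : ℕ) < h) \
        (Finset.univ.filter fun c : Fin D => (c : ℕ) < i)).card := by
    unfold hammingDist initialVertex
    congr 1; ext c
    simp only [Finset.mem_filter, Finset.mem_univ, true_and, Finset.mem_sdiff]
    by_cases h1 : (c : ℕ) < h <;> by_cases h2 : (c : ℕ) < i <;> simp [h1, h2]
    omega
  rw [this, Finset.card_sdiff_of_subset fun c => by simp; omega, card_filter_coe_lt hD,
    card_filter_coe_lt (hi.trans hD)]

theorem hammingNumber_ne_zero_of_eq_add {h i j : ℕ} (hh : h ≤ D) (hi : i ≤ D) (hj : j ≤ D)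
    (hij : h = i + j ∨ i = h + j ∨ j = h + i) : hammingNumber D h i j ≠ 0 := by
  have h0 : initialVertex D 0 = 0 := by ext c; simp [initialVertex]
  rcases hij with hij | hij | hij
  · exact hammingNumber_ne_zero hi hj 0 (initialVertex D h) (initialVertex D i)
      (hammingDist_initialVertex hh) (hammingDist_initialVertex hi)
      (by rw [hammingDist_initialVertex_initialVertex (by omega) hh]; omega)
  · exact hammingNumber_ne_zero hi hj 0 (initialVertex D h) (initialVertex D i)
      (hammingDist_initialVertex hh) (hammingDist_initialVertex hi)
      (by rw [hammingDist_comm, hammingDist_initialVertex_initialVertex (by omega) hi]; omega)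
  · exact hammingNumber_ne_zero hi hj (initialVertex D h) 0 (initialVertex D j)
      (by rw [hammingDist_comm, hammingDist_initialVertex hh])
      (by rw [hammingDist_initialVertex_initialVertex (by omega) hj]; omega)
      (by rw [hammingDist_comm, hammingDist_initialVertex hj])

theorem hammingNumber_self_ne_zero {h j : ℕ} (hh : h ≤ j) (hj : j ≤ D) :
    hammingNumber D h j j ≠ 0 := by
  refine hammingNumber_ne_zero hj hj 0 (initialVertex D h)
    (fun c => if (c : ℕ) < j then 2 else 0) (hammingDist_initialVertex (hh.trans hj)) ?_ ?_
  all_goals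
    conv_rhs => rw [← card_filter_coe_lt hj]
    unfold hammingDist
    congr 1; ext c
    rw [Finset.mem_filter, Finset.mem_filter]
    simp only [initialVertex, Finset.mem_univ, true_and, Pi.zero_apply]
    by_cases h1 : (c : ℕ) < h <;> by_cases h2 : (c : ℕ) < j <;> simp [h1, h2]
  omega

theorem hammingNumber_three_two_two_ne_zero (hD : 3 ≤ D) : hammingNumber D 3 2 2 ≠ 0 := by
  refine hammingNumber_ne_zero (by omega) (by omega) 0 (initialVertex D 3)
    (fun c => if (c : ℕ) = 0 then 2 else if (c : ℕ) = 1 then 1 else 0)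
    (hammingDist_initialVertex hD) ?_ ?_
  · rw [hammingDist, Finset.card_eq_two]
    refine ⟨⟨0, by omega⟩, ⟨1, by omega⟩, by simp, ?_⟩
    ext c
    simp only [Finset.mem_filter, Finset.mem_univ, true_and, Pi.zero_apply, Finset.mem_insert,
      Finset.mem_singleton, Fin.ext_iff (n := D)]
    split_ifs <;> simp_all
  · rw [hammingDist, Finset.card_eq_two]
    refine ⟨⟨0, by omega⟩, ⟨2, by omega⟩, by simp, ?_⟩
    ext c
    rw [Finset.mem_filter]
    simp only [initialVertex, Finset.mem_univ, true_and, Finset.mem_insert,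
      Finset.mem_singleton, Fin.ext_iff (n := D)]
    split_ifs <;> simp_all <;> omega

theorem IsHammingLike.diam_eq (hΓ : IsHammingLike Γ D) : Γ.diam = D := by
  have := hΓ.connected.nonempty
  have htop := SimpleGraph.connected_iff_ediam_ne_top.1 hΓ.connected
  obtain ⟨u, v, huv⟩ := Γ.exists_dist_eq_diam
  refine le_antisymm (huv ▸ hΓ.dist_le _ _) ?_
  have h := hΓ.card_eq_hammingNumber le_rfl le_rfl u u
  rw [SimpleGraph.dist_self] at h
  have h' := hammingNumber_ne_zero_of_eq_add (Nat.zero_le D) le_rfl le_rfl (by simp)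
  rw [← h, Finset.card_ne_zero] at h'
  obtain ⟨z, hz⟩ := h'
  rw [Finset.mem_filter] at hz
  exact hz.2.1 ▸ SimpleGraph.dist_le_diam htop

theorem IsHammingLike.hasIntersectionNumbers [DecidableEq X] (hΓ : IsHammingLike Γ D) :
    HasIntersectionNumbers Γ D (hammingNumber D) := by
  refine ⟨hΓ.connected, hΓ.diam_eq, ?_⟩
  rintro h i j hh hi hj x y rfl
  rw [← hΓ.card_eq_hammingNumber hi hj]
  congr 1; ext z
  simp [sphere, SimpleGraph.dist_comm (u := z)]

end IntersectionNumbers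

section Krawtchouk

open Polynomial in
/-- The Krawtchouk polynomial of degree `j` for `H(D,4)`, evaluated at `d`. -/
noncomputable def krawtchouk (D j d : ℕ) : ℝ :=
  (((1 + C 3 * X) ^ (D - d) * (1 + C (-1) * X) ^ d : ℝ[X])).coeff j

variable {D d : ℕ}

theorem sum_krawtchouk_mul_pow (hd : d ≤ D) (r : ℝ) :
    ∑ j ∈ Finset.range (D + 1), krawtchouk D j d * r ^ j =
      (1 + 3 * r) ^ (D - d) * (1 - r) ^ d := by
  have hdeg : ∀ c : ℝ, (1 + Polynomial.C c * Polynomial.X).natDegree ≤ 1 := fun c => by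
    compute_degree
  unfold krawtchouk
  rw [← Polynomial.eval_eq_sum_range' (n := D + 1)]
  · simp [sub_eq_add_neg]
  · refine Nat.lt_succ_of_le (Polynomial.natDegree_mul_le.trans ?_)
    have h1 := Polynomial.natDegree_pow_le_of_le (D - d) (hdeg 3)
    have h2 := Polynomial.natDegree_pow_le_of_le d (hdeg (-1))
    omega

theorem sum_krawtchouk_mul_pow_mul_pow (hd : d ≤ D) {a : ℝ} (ha : a ≠ 0) (b : ℝ) :
    ∑ j ∈ Finset.range (D + 1), krawtchouk D j d * (a ^ (D - j) * b ^ j) =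
      (a + 3 * b) ^ (D - d) * (a - b) ^ d := by
  have h : ∀ j ∈ Finset.range (D + 1), krawtchouk D j d * (a ^ (D - j) * b ^ j) =
      a ^ D * (krawtchouk D j d * (b / a) ^ j) := by
    intro j hj
    have hj' : j ≤ D := Nat.lt_succ_iff.1 (Finset.mem_range.1 hj)
    rw [div_pow, pow_sub₀ a ha hj']
    field_simp
  rw [Finset.sum_congr rfl h, ← Finset.mul_sum, sum_krawtchouk_mul_pow hd]
  conv_lhs => rw [← Nat.sub_add_cancel hd, Nat.add_sub_cancel, pow_add]
  rw [mul_mul_mul_comm, ← mul_pow, ← mul_pow]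
  congr 2 <;> field_simp

theorem krawtchouk_zero (D d : ℕ) : krawtchouk D 0 d = 1 := by
  simp [krawtchouk, Polynomial.coeff_zero_eq_eval_zero]

theorem krawtchouk_one (hd : d ≤ D) : krawtchouk D 1 d = 3 * D - 4 * d := by
  have h : ∀ (c : ℝ) (n : ℕ),
      ((1 + Polynomial.C c * Polynomial.X) ^ n : Polynomial ℝ).coeff 1 = n * c ∧
      ((1 + Polynomial.C c * Polynomial.X) ^ n : Polynomial ℝ).coeff 0 = 1 := by
    intro c n
    induction n with
    | zero => simp [Polynomial.coeff_one]
    | succ n ih =>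
      rw [pow_succ, Polynomial.mul_coeff_one, Polynomial.mul_coeff_zero, ih.1, ih.2]
      simp [Polynomial.coeff_one]
      ring
  rw [krawtchouk, Polynomial.mul_coeff_one, (h _ _).1, (h _ _).2, (h _ _).1, (h _ _).2]
  push_cast [hd]
  ring

/-- Krawtchouk polynomials are self-dual and orthogonal. -/
theorem sum_krawtchouk_mul_krawtchouk {i : ℕ} (hi : i ≤ D) (hd : d ≤ D) :
    ∑ j ∈ Finset.range (D + 1), krawtchouk D i j * krawtchouk D j d =
      if d = i then 4 ^ D else 0 := by
  refine coeff_eq_of_forall_pos (n := D + 1)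
    (c := fun i => ∑ j ∈ Finset.range (D + 1), krawtchouk D i j * krawtchouk D j d)
    (c' := fun i => if d = i then 4 ^ D else 0) (fun s hs => ?_) i (by simp; omega)
  have h1 : 1 + 3 * s ≠ 0 := by positivity
  have h2 := sum_krawtchouk_mul_pow_mul_pow hd h1 (1 - s)
  rw [show 1 + 3 * s + 3 * (1 - s) = 4 by ring, show 1 + 3 * s - (1 - s) = 4 * s by ring, mul_pow,
    ← mul_assoc, ← pow_add, Nat.sub_add_cancel hd] at h2
  simp only [ite_mul, zero_mul, Finset.sum_ite_eq, Finset.mem_range, Nat.lt_succ_iff.2 hd, if_true]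
  rw [← h2]
  simp only [Finset.sum_mul]
  rw [Finset.sum_comm]
  refine Finset.sum_congr rfl fun j hj => ?_
  rw [← sum_krawtchouk_mul_pow (Nat.lt_succ_iff.1 (Finset.mem_range.1 hj)), Finset.mul_sum]
  exact Finset.sum_congr rfl fun _ _ => by ring

theorem krawtchouk_mul_krawtchouk {i j : ℕ} (hi : i ≤ D) (hj : j ≤ D) (hd : d ≤ D) :
    krawtchouk D i d * krawtchouk D j d =
      ∑ h ∈ Finset.range (D + 1), (hammingNumber D h i j : ℝ) * krawtchouk D h d := by
  refine coeff_eq_of_forall_pos₂ (n := D + 1)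
    (c := fun i j => krawtchouk D i d * krawtchouk D j d)
    (c' := fun i j => ∑ h ∈ Finset.range (D + 1),
      (hammingNumber D h i j : ℝ) * krawtchouk D h d) (fun r u hr hu => ?_)
    i (by simp; omega) j (by simp; omega)
  have h1 : 1 + 3 * (r * u) ≠ 0 := by positivity
  have h2 := sum_krawtchouk_mul_pow_mul_pow hd h1 (r + u + 2 * (r * u))
  rw [show 1 + 3 * (r * u) + 3 * (r + u + 2 * (r * u)) = (1 + 3 * r) * (1 + 3 * u) by ring,
    show 1 + 3 * (r * u) - (r + u + 2 * (r * u)) = (1 - r) * (1 - u) by ring, mul_pow, mul_pow,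
    mul_mul_mul_comm, ← sum_krawtchouk_mul_pow hd, ← sum_krawtchouk_mul_pow hd,
    Finset.sum_mul_sum] at h2
  simp only [mul_mul_mul_comm _ (r ^ _)] at h2
  rw [← h2]
  simp only [Finset.sum_mul]
  simp_rw [Finset.sum_comm (s := Finset.range (D + 1)) (t := Finset.range (D + 1))
    (f := fun j h => (hammingNumber D h _ j : ℝ) * krawtchouk D h d * (r ^ _ * u ^ j))]
  rw [Finset.sum_comm]
  refine Finset.sum_congr rfl fun h hh => ?_
  rw [← sum_hammingNumber_mul_pow (Nat.lt_succ_iff.1 (Finset.mem_range.1 hh)), Finset.mul_sum]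
  refine Finset.sum_congr rfl fun i _ => ?_
  rw [Finset.mul_sum]
  exact Finset.sum_congr rfl fun _ _ => by ring

theorem krawtchouk_self_zero_ne_zero {j : ℕ} (hj : j ≤ D) : krawtchouk D j 0 ≠ 0 := by
  have h : ((1 + Polynomial.C 3 * Polynomial.X) ^ D : Polynomial ℝ) =
      ((1 + Polynomial.X) ^ D : Polynomial ℝ).comp (Polynomial.C 3 * Polynomial.X) := by simp
  rw [krawtchouk, pow_zero, mul_one, Nat.sub_zero, h, Polynomial.comp_C_mul_X_coeff,
    Polynomial.coeff_one_add_X_pow]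
  have := Nat.choose_pos hj
  positivity

end Krawtchouk

variable {X : Type*} [Fintype X] {Γ : SimpleGraph X} {D : ℕ}

theorem IsHammingLike.card_eq (hΓ : IsHammingLike Γ D) : Fintype.card X = 4 ^ D := by
  obtain ⟨x⟩ := hΓ.connected.nonempty
  have h := hΓ.sum_pow x x 1 1 1 1
  norm_num at h
  exact_mod_cast h

theorem IsHammingLike.sum_krawtchouk_mul_krawtchouk (hΓ : IsHammingLike Γ D) {i j : ℕ}
    (hi : i ≤ D) (hj : j ≤ D) (x y : X) :
    ∑ z, krawtchouk D i (Γ.dist x z) * krawtchouk D j (Γ.dist z y) =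
      if i = j then 4 ^ D * krawtchouk D i (Γ.dist x y) else 0 := by
  refine coeff_eq_of_forall_pos₂ (n := D + 1)
    (c := fun i j => ∑ z, krawtchouk D i (Γ.dist x z) * krawtchouk D j (Γ.dist z y))
    (c' := fun i j => if i = j then 4 ^ D * krawtchouk D i (Γ.dist x y) else 0)
    (fun r u hr hu => ?_) i (by simp; omega) j (by simp; omega)
  have h := hΓ.sum_pow x y (1 + 3 * r) (1 - r) (1 + 3 * u) (1 - u)
  rw [show (1 + 3 * r) * (1 + 3 * u) + 3 * ((1 - r) * (1 - u)) = 4 * (1 + 3 * (r * u)) by ring,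
    show (1 + 3 * r) * (1 - u) + (1 - r) * (1 + 3 * u) + 2 * ((1 - r) * (1 - u)) =
      4 * (1 - r * u) by ring, mul_pow, mul_pow, mul_mul_mul_comm, ← pow_add,
    Nat.sub_add_cancel (hΓ.dist_le x y), ← sum_krawtchouk_mul_pow (hΓ.dist_le x y)] at h
  simp only [← sum_krawtchouk_mul_pow (hΓ.dist_le _ _), Finset.sum_mul_sum] at h
  simp only [ite_mul, zero_mul, Finset.sum_ite_eq, Finset.sum_mul]
  rw [Finset.sum_congr rfl fun i hi => if_pos hi]
  rw [Finset.mul_sum] at h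
  convert h using 1
  · rw [Finset.sum_comm]
    simp_rw [Finset.sum_comm (s := Finset.univ) (t := Finset.range (D + 1))]
    rw [Finset.sum_comm]
    exact Finset.sum_congr rfl fun _ _ => Finset.sum_congr rfl fun _ _ =>
      Finset.sum_congr rfl fun _ _ => by ring
  · exact Finset.sum_congr rfl fun _ _ => by ring


section Idempotents

variable {X : Type*} {Γ : SimpleGraph X} {D : ℕ}

/-- The primitive idempotents of a graph with the distance counts of `H(D,4)`. -/
noncomputable def krawtchoukIdempotent (Γ : SimpleGraph X) (D j : ℕ) : Matrix X X ℝ :=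
  Matrix.of fun x y => ((4 : ℝ) ^ D)⁻¹ * krawtchouk D j (Γ.dist x y)

theorem krawtchoukIdempotent_apply (j : ℕ) (x y : X) :
    krawtchoukIdempotent Γ D j x y = ((4 : ℝ) ^ D)⁻¹ * krawtchouk D j (Γ.dist x y) := rfl

variable [Fintype X]

theorem IsHammingLike.krawtchoukIdempotent_mul (hΓ : IsHammingLike Γ D) {i j : ℕ} (hi : i ≤ D)
    (hj : j ≤ D) : krawtchoukIdempotent Γ D i * krawtchoukIdempotent Γ D j =
      if i = j then krawtchoukIdempotent Γ D i else 0 := by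
  ext x y
  simp only [Matrix.mul_apply, krawtchoukIdempotent_apply]
  simp only [mul_mul_mul_comm _ (krawtchouk _ _ _), ← Finset.mul_sum,
    hΓ.sum_krawtchouk_mul_krawtchouk hi hj]
  split_ifs
  · rw [krawtchoukIdempotent_apply]; field_simp
  · simp

theorem IsHammingLike.krawtchoukIdempotent_ne_zero (hΓ : IsHammingLike Γ D) {j : ℕ} (hj : j ≤ D) :
    krawtchoukIdempotent Γ D j ≠ 0 := by
  obtain ⟨x⟩ := hΓ.connected.nonempty
  intro h
  have := congrFun (congrFun h x) x
  simp [krawtchoukIdempotent_apply, krawtchouk_self_zero_ne_zero hj] at this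

theorem IsHammingLike.distMatrix_eq (hΓ : IsHammingLike Γ D) {i : ℕ} (hi : i ≤ D) :
    distMatrix Γ i = ∑ j : Fin (D + 1), krawtchouk D i j • krawtchoukIdempotent Γ D j := by
  ext x y
  simp only [Matrix.sum_apply, Matrix.smul_apply, krawtchoukIdempotent_apply, smul_eq_mul,
    mul_left_comm _ ((4 : ℝ) ^ D)⁻¹, ← Finset.mul_sum]
  rw [Fin.sum_univ_eq_sum_range (fun j => krawtchouk D i j * krawtchouk D j (Γ.dist x y)),
    DRG.sum_krawtchouk_mul_krawtchouk hi (hΓ.dist_le x y)]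
  by_cases h : Γ.dist x y = i <;> simp [distMatrix, h]

theorem IsHammingLike.krawtchoukIdempotent_eq (hΓ : IsHammingLike Γ D) (j : ℕ) :
    krawtchoukIdempotent Γ D j =
      ∑ i : Fin (D + 1), (((4 : ℝ) ^ D)⁻¹ * krawtchouk D j i) • distMatrix Γ i := by
  ext x y
  simp only [Matrix.sum_apply, Matrix.smul_apply, krawtchoukIdempotent_apply, smul_eq_mul,
    distMatrix, Matrix.of_apply, mul_ite, mul_one, mul_zero]
  rw [Fin.sum_univ_eq_sum_range
    (fun i => if Γ.dist x y = i then ((4 : ℝ) ^ D)⁻¹ * krawtchouk D j i else 0)]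
  simp [Nat.lt_succ_iff.2 (hΓ.dist_le x y)]

/-- Nonzero orthogonal idempotents are linearly independent. -/
theorem linearIndependent_of_orthogonal {R ι : Type*} [Ring R] [Algebra ℝ R] [Fintype ι]
    [DecidableEq ι] {E : ι → R} (hE : ∀ i j, E i * E j = if i = j then E i else 0)
    (h0 : ∀ i, E i ≠ 0) : LinearIndependent ℝ E := by
  rw [Fintype.linearIndependent_iff]
  intro g hg i
  have := congrArg (· * E i) hg
  simp only [Finset.sum_mul, smul_mul_assoc, hE, smul_ite, smul_zero, zero_mul] at this
  simpa [h0] using this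

theorem IsHammingLike.isKrein (hΓ : IsHammingLike Γ D) :
    IsKrein (fun j : Fin (D + 1) => krawtchoukIdempotent Γ D j)
      fun h i j => (hammingNumber D h i j : ℝ) := by
  intro i j
  ext x y
  simp only [Matrix.hadamard_apply, Matrix.smul_apply, Matrix.sum_apply,
    krawtchoukIdempotent_apply, smul_eq_mul, hΓ.card_eq, mul_left_comm _ ((4 : ℝ) ^ D)⁻¹,
    ← Finset.mul_sum, mul_assoc]
  rw [krawtchouk_mul_krawtchouk i.is_le j.is_le (hΓ.dist_le x y),
    Fin.sum_univ_eq_sum_range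
      (fun h => (hammingNumber D h i j : ℝ) * krawtchouk D h (Γ.dist x y))]
  push_cast
  ring

variable [DecidableEq X]

theorem IsHammingLike.isPrimitiveIdempotents (hΓ : IsHammingLike Γ D) :
    IsPrimitiveIdempotents Γ fun j : Fin (D + 1) => krawtchoukIdempotent Γ D j := by
  have hmul : ∀ i j : Fin (D + 1),
      krawtchoukIdempotent Γ D i * krawtchoukIdempotent Γ D j =
        if i = j then krawtchoukIdempotent Γ D i else 0 := fun i j => by
    simp only [hΓ.krawtchoukIdempotent_mul i.is_le j.is_le, Fin.ext_iff]
  refine ⟨linearIndependent_of_orthogonal hmul fun i => hΓ.krawtchoukIdempotent_ne_zero i.is_le,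
    le_antisymm ?_ ?_, ?_, ?_, fun i => ?_, hmul⟩
  · rw [Submodule.span_le]
    rintro _ ⟨j, rfl⟩
    dsimp only
    rw [hΓ.krawtchoukIdempotent_eq]
    exact Submodule.sum_smul_mem _ _ fun i _ => Submodule.subset_span ⟨i, rfl⟩
  · rw [boseMesner, Submodule.span_le]
    rintro _ ⟨i, rfl⟩
    dsimp only
    rw [hΓ.distMatrix_eq i.is_le]
    exact Submodule.sum_smul_mem _ _ fun j _ => Submodule.subset_span ⟨j, rfl⟩
  · ext x y
    simp [krawtchoukIdempotent_apply, krawtchouk_zero, hΓ.card_eq]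
  · ext x y
    simp only [Matrix.sum_apply, krawtchoukIdempotent_apply, ← Finset.mul_sum]
    rw [Fin.sum_univ_eq_sum_range (fun j => krawtchouk D j (Γ.dist x y))]
    have := sum_krawtchouk_mul_pow (hΓ.dist_le x y) 1
    simp only [one_pow, mul_one, sub_self] at this
    rw [this]
    by_cases h : x = y
    · subst h; norm_num
    · rw [Matrix.one_apply_ne h, zero_pow (mt hΓ.connected.dist_eq_zero_iff.1 h)]; simp
  · ext x y
    simp [krawtchoukIdempotent_apply, SimpleGraph.dist_comm (u := x)]

theorem IsHammingLike.isStandardOrdering (hΓ : IsHammingLike Γ D) (hD : 1 ≤ D) :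
    IsStandardOrdering Γ fun j : Fin (D + 1) => krawtchoukIdempotent Γ D j := by
  refine ⟨⟨⟨_, hΓ.hasIntersectionNumbers⟩, hΓ.isPrimitiveIdempotents, _, hΓ.isKrein,
    fun h i j => ⟨fun hij => ?_, fun hij => ?_⟩⟩, fun i => ?_⟩
  · rw [hammingNumber_eq_zero h.is_le hij, Nat.cast_zero]
  · exact_mod_cast hammingNumber_ne_zero_of_eq_add h.is_le i.is_le j.is_le hij
  · rw [hΓ.distMatrix_eq hD, Finset.sum_mul, ← krawtchouk_one i.is_le]
    simp [hΓ.isPrimitiveIdempotents.2.2.2.2.2]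

end Idempotents

section Uniqueness

variable {X : Type*} [Fintype X] [DecidableEq X] {Γ : SimpleGraph X} {D : ℕ}

/-- Two orderings of the primitive idempotents differ by a permutation. -/
theorem IsPrimitiveIdempotents.exists_injective {E F : Fin (D + 1) → Matrix X X ℝ}
    (hE : IsPrimitiveIdempotents Γ E) (hF : IsPrimitiveIdempotents Γ F) :
    ∃ σ : Fin (D + 1) → Fin (D + 1), σ.Injective ∧ ∀ i, E i = F (σ i) := by
  obtain ⟨hEli, hEs, -, -, -, hEm⟩ := hE
  obtain ⟨hFli, hFs, -, -, -, hFm⟩ := hF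
  have hc : ∀ i, ∃ c : Fin (D + 1) → ℝ, ∑ k, c k • F k = E i := fun i => by
    rw [← Submodule.mem_span_range_iff_exists_fun, hFs, ← hEs]
    exact Submodule.subset_span ⟨i, rfl⟩
  choose c hc using hc
  have hm : ∀ i j k, c i k * c j k = if i = j then c i k else 0 := by
    intro i j k
    have h1 : ∑ k, (c i k * c j k) • F k = ∑ k, (if i = j then c i k else 0) • F k := by
      have h2 := hEm i j
      rw [← hc i, ← hc j] at h2
      simp only [Finset.sum_mul, Finset.mul_sum, smul_mul_smul_comm, hFm, smul_ite, smul_zero,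
        Finset.sum_ite_eq', Finset.mem_univ, if_true] at h2
      rw [h2]
      split_ifs <;> simp
    have h3 := Fintype.linearIndependent_iff.1 hFli
      (fun k => c i k * c j k - if i = j then c i k else 0)
      (by simp only [sub_smul, Finset.sum_sub_distrib, h1, sub_self]) k
    exact sub_eq_zero.1 h3
  have hne : ∀ i, ∃ k, c i k ≠ 0 := by
    intro i
    by_contra! h
    apply hEli.ne_zero i
    rw [← hc i]
    simp [h]
  choose σ hσ using hne
  have hinj : σ.Injective := by
    intro i j hij
    by_contra hne
    have := hm i j (σ i)
    rw [if_neg hne] at this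
    rcases mul_eq_zero.1 this with h | h
    · exact hσ i h
    · rw [hij] at h; exact hσ j h
  refine ⟨σ, hinj, fun i => ?_⟩
  rw [← hc i, Finset.sum_eq_single (σ i)]
  · have := hm i i (σ i)
    rw [if_pos rfl] at this
    rw [mul_left_eq_self₀.1 this |>.resolve_right (hσ i), one_smul]
  · intro k _ hk
    obtain ⟨j, rfl⟩ := (Finite.injective_iff_surjective.1 hinj) k
    have := hm i j (σ j)
    rw [if_neg (by rintro rfl; exact hk rfl)] at this
    rw [(mul_eq_zero.1 this).resolve_right (hσ j), zero_smul]
  · simp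

/-- The `Q`-polynomial primitive idempotent is unique. -/
theorem IsHammingLike.eq_krawtchoukIdempotent_one (hΓ : IsHammingLike Γ D) (hD : 3 ≤ D)
    {E : Fin (D + 1) → Matrix X X ℝ} (hE : IsQPolynomialOrdering Γ E) {i : Fin (D + 1)}
    (hi : (i : ℕ) = 1) : E i = krawtchoukIdempotent Γ D 1 := by
  obtain ⟨-, hEp, q, hq, hq'⟩ := hE
  have hF := hΓ.isPrimitiveIdempotents
  obtain ⟨σ, hσ, hσE⟩ := hEp.exists_injective hF
  have hsurj := Finite.injective_iff_surjective.1 hσ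
  have hσ0 : σ 0 = 0 := hF.1.injective (((hσE 0).symm.trans hEp.2.2.1).trans hF.2.2.1.symm)
  have hcoef : ∀ h, q h i i = hammingNumber D (σ h) (σ i) (σ i) := by
    have h1 := hq i i
    rw [hσE i, hΓ.isKrein] at h1
    have hcard : (Fintype.card X : ℝ)⁻¹ ≠ 0 := by rw [hΓ.card_eq]; positivity
    have h2 := smul_right_injective _ hcard h1
    rw [← (Equiv.ofBijective σ ⟨hσ, hsurj⟩).sum_comp] at h2
    have h4 : ∑ h, q h i i • E h =
        ∑ h, (hammingNumber D (σ h) (σ i) (σ i) : ℝ) • E h := by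
      rw [← h2]
      exact Finset.sum_congr rfl fun h _ => by rw [hσE h]; rfl
    intro h
    have h3 := Fintype.linearIndependent_iff.1 hEp.1
      (fun h => q h i i - hammingNumber D (σ h) (σ i) (σ i))
      (by simp only [sub_smul, Finset.sum_sub_distrib, h4, sub_self]) h
    exact sub_eq_zero.1 h3
  have hbig : ∀ k : Fin (D + 1), hammingNumber D k (σ i) (σ i) ≠ 0 →
      k = 0 ∨ k = σ i ∨ k = σ ⟨2, by omega⟩ := by
    intro k hk
    obtain ⟨h, rfl⟩ := hsurj k
    have h1 : ¬ (2 < (h : ℕ)) := fun h2 => hk (by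
      have h3 := (hq' h i i).1 (Or.inl (by omega))
      rw [hcoef] at h3
      exact_mod_cast h3)
    have h2 : h = 0 ∨ h = i ∨ h = ⟨2, by omega⟩ := by
      simp only [Fin.ext_iff, Fin.val_zero]; omega
    rcases h2 with h2 | h2 | h2
    · exact Or.inl (h2 ▸ hσ0)
    · exact Or.inr (Or.inl (congrArg σ h2))
    · exact Or.inr (Or.inr (congrArg σ h2))
  have hi0 : (σ i : ℕ) ≠ 0 := by
    intro h
    have : σ i = σ 0 := by rw [hσ0]; exact Fin.ext h
    rw [hσ this] at hi
    simp at hi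
  have hle := (σ i).is_le
  have hi1 : (σ i : ℕ) = 1 := by
    by_contra hne
    have h1 := hbig ⟨1, by omega⟩ (hammingNumber_self_ne_zero (by dsimp only; omega) hle)
    by_cases h2 : (σ i : ℕ) = 2
    · have h3 := hbig ⟨3, by omega⟩ (by
        rw [h2]; exact hammingNumber_three_two_two_ne_zero hD)
      simp only [Fin.ext_iff, Fin.val_zero] at h1 h3
      omega
    · have h3 := hbig ⟨2, by omega⟩ (hammingNumber_self_ne_zero (by dsimp only; omega) hle)
      simp only [Fin.ext_iff, Fin.val_zero] at h1 h3
      omega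
  rw [hσE, hi1]

end Uniqueness

section ProductSums

variable {ι : Type*} [DecidableEq ι] {V : ι → Type*}

theorem card_mul_sum_eq_sum_update [Fintype ι] [∀ i, Fintype (V i)] (i : ι)
    (F : (∀ i, V i) → ℝ) :
    (Fintype.card (V i) : ℝ) * ∑ z, F z = ∑ z, ∑ a, F (Function.update z i a) := by
  let e : (∀ i, V i) × V i ≃ (∀ i, V i) × V i :=
    ⟨fun p => (Function.update p.1 i p.2, p.1 i), fun p => (Function.update p.1 i p.2, p.1 i),
      fun p => by simp, fun p => by simp⟩
  have h := Equiv.sum_comp e fun p => F p.1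
  rw [Fintype.sum_prod_type, Fintype.sum_prod_type] at h
  simp only [e, Equiv.coe_fn_mk, Finset.sum_const, Finset.card_univ, nsmul_eq_mul,
    ← Finset.mul_sum] at h
  exact h.symm

theorem sum_mul_eq_zero_of_update [Fintype ι] [∀ i, Fintype (V i)] {i : ι} {f : V i → ℝ}
    (hf : ∑ a, f a = 0) {h : (∀ i, V i) → ℝ} (hh : ∀ z a, h (Function.update z i a) = h z) :
    ∑ z : ∀ i, V i, f (z i) * h z = 0 := by
  rcases isEmpty_or_nonempty (V i) with hV | hV
  · have : IsEmpty (∀ i, V i) := ⟨fun z => hV.elim (z i)⟩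
    simp
  have h1 := card_mul_sum_eq_sum_update i fun z : ∀ i, V i => f (z i) * h z
  simp only [Function.update_self, hh, ← Finset.sum_mul, hf, zero_mul, Finset.sum_const_zero] at h1
  exact (mul_eq_zero.1 h1).resolve_left (by exact_mod_cast Fintype.card_ne_zero)

theorem sum_mul_sum_mul_sum [Fintype ι] [∀ i, Fintype (V i)] [∀ i, Nonempty (V i)]
    {p q r : ∀ i, V i → ℝ} (hp : ∀ i, ∑ a, p i a = 0) (hq : ∀ i, ∑ a, q i a = 0)
    (hr : ∀ i, ∑ a, r i a = 0) :
    ∑ z : ∀ i, V i, (∑ i, p i (z i)) * (∑ i, q i (z i)) * (∑ i, r i (z i)) =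
      Fintype.card (∀ i, V i) *
        ∑ i, (Fintype.card (V i) : ℝ)⁻¹ * ∑ a, p i a * q i a * r i a := by
  have h1 : ∀ i j k, ¬(j = i ∧ k = i) →
      ∑ z : ∀ i, V i, p i (z i) * q j (z j) * r k (z k) = 0 := by
    intro i j k h
    by_cases hj : j = i
    · subst hj
      have hk : k ≠ j := fun hk => h ⟨rfl, hk⟩
      rw [← sum_mul_eq_zero_of_update (hr k) (h := fun z => p j (z j) * q j (z j))
        fun z a => by simp [Function.update_of_ne hk.symm]]
      exact Finset.sum_congr rfl fun z _ => by ring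
    · by_cases hk : k = i
      · subst hk
        rw [← sum_mul_eq_zero_of_update (hq j) (h := fun z => p k (z k) * r k (z k))
          fun z a => by simp [Function.update_of_ne (Ne.symm hj)]]
        exact Finset.sum_congr rfl fun z _ => by ring
      · rw [← sum_mul_eq_zero_of_update (hp i) (h := fun z => q j (z j) * r k (z k))
          fun z a => by simp [Function.update_of_ne hj, Function.update_of_ne hk]]
        exact Finset.sum_congr rfl fun z _ => by ring
  have h0 : ∀ z : ∀ i, V i, (∑ i, p i (z i)) * (∑ i, q i (z i)) * (∑ i, r i (z i)) =
      ∑ i, ∑ j, ∑ k, p i (z i) * q j (z j) * r k (z k) := fun z => by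
    rw [Finset.sum_mul_sum, Finset.sum_mul]
    refine Finset.sum_congr rfl fun i _ => ?_
    rw [Finset.sum_mul]
    exact Finset.sum_congr rfl fun j _ => Finset.mul_sum _ _ _
  simp only [h0]
  rw [Finset.sum_comm, Finset.mul_sum]
  refine Finset.sum_congr rfl fun i _ => ?_
  rw [Finset.sum_comm, Finset.sum_eq_single i, Finset.sum_comm, Finset.sum_eq_single i]
  · have h2 := card_mul_sum_eq_sum_update i fun z : ∀ i, V i =>
      p i (z i) * q i (z i) * r i (z i)
    simp only [Function.update_self, Finset.sum_const, Finset.card_univ, nsmul_eq_mul] at h2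
    have h3 : (Fintype.card (V i) : ℝ) ≠ 0 := by exact_mod_cast Fintype.card_ne_zero
    rw [mul_left_comm, ← h2]
    field_simp
  · exact fun k _ hk => h1 i i k fun h => hk h.2
  · simp
  · intro j _ hj
    rw [Finset.sum_comm]
    exact Finset.sum_eq_zero fun k _ => h1 i j k fun h => hj h.1
  · simp

theorem eq_of_forall_sum_eq_zero [Fintype ι] {h : ∀ i, V i → ℝ}
    (hh : ∀ z : ∀ i, V i, ∑ i, h i (z i) = 0) (z : ∀ i, V i) (i : ι) (a : V i) :
    h i a = h i (z i) := by
  have h1 := hh z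
  have h2 := hh (Function.update z i a)
  rw [← Finset.add_sum_erase _ _ (Finset.mem_univ i)] at h1 h2
  rw [Function.update_self, Finset.sum_congr rfl (g := fun i => h i (z i))
        (fun j hj' => by rw [Function.update_of_ne (Finset.ne_of_mem_erase hj')])] at h2
  linarith

end ProductSums

section Kernel

variable {X Y : Type*}

/-- The entries of the idempotent `E_1`, up to the factor `4 ^ D`. -/
noncomputable def kernel (Γ : SimpleGraph X) (D : ℕ) (x y : X) : ℝ := 3 * D - 4 * Γ.dist x y

/-- The entries of the Norton product, up to the factor `16 ^ D`. -/
noncomputable def tripleKernel [Fintype X] (Γ : SimpleGraph X) (D : ℕ) (w x y : X) : ℝ :=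
  ((4 : ℝ) ^ D)⁻¹ * ∑ z, kernel Γ D w z * kernel Γ D x z * kernel Γ D y z

theorem kernel_comm (Γ : SimpleGraph X) (D : ℕ) (x y : X) : kernel Γ D x y = kernel Γ D y x := by
  rw [kernel, kernel, SimpleGraph.dist_comm]

variable {Γ : SimpleGraph X} {D : ℕ}

theorem kernel_iso {H : SimpleGraph Y} (hH : H.Connected) (φ : Γ ≃g H) (x y : X) :
    kernel Γ D x y = kernel H D (φ x) (φ y) := by
  rw [kernel, kernel, (connected_and_dist_iso hH φ).2]

theorem tripleKernel_iso [Fintype X] [Fintype Y] {H : SimpleGraph Y} (hH : H.Connected)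
    (φ : Γ ≃g H) (w x y : X) :
    tripleKernel Γ D w x y = tripleKernel H D (φ w) (φ x) (φ y) := by
  simp only [tripleKernel, kernel_iso hH φ]
  congr 1
  exact Equiv.sum_comp φ.toEquiv fun z =>
    kernel H D (φ w) z * kernel H D (φ x) z * kernel H D (φ y) z

theorem IsHammingLike.sum_kernel [Fintype X] (hΓ : IsHammingLike Γ D) (hD : 1 ≤ D) (x : X) :
    ∑ y, kernel Γ D x y = 0 := by
  have h := hΓ.sum_krawtchouk_mul_krawtchouk hD (Nat.zero_le D) x x
  simpa only [krawtchouk_zero, mul_one, krawtchouk_one (hΓ.dist_le _ _), one_ne_zero, if_false,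
    kernel] using h

theorem kernel_top (a b : Fin 4) :
    kernel (⊤ : SimpleGraph (Fin 4)) 1 a b = if a = b then 3 else -1 := by
  rw [kernel, SimpleGraph.dist_top]; split_ifs <;> norm_num

theorem tripleKernel_top (a b c : Fin 4) :
    tripleKernel (⊤ : SimpleGraph (Fin 4)) 1 a b c =
      if b = c then 2 * kernel (⊤ : SimpleGraph (Fin 4)) 1 a b
      else -kernel (⊤ : SimpleGraph (Fin 4)) 1 a b - kernel (⊤ : SimpleGraph (Fin 4)) 1 a c := by
  simp only [tripleKernel, kernel_top, Fin.sum_univ_four]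
  fin_cases a <;> fin_cases b <;> fin_cases c <;> norm_num [Fin.ext_iff]

theorem kernel_shrikhande (x y : ZMod 4 × ZMod 4) :
    kernel shrikhande 2 x y = ((6 - 4 * (shrikhandeWeight (y - x) : ℤ) : ℤ) : ℝ) := by
  rw [kernel, shrikhande_connected_and_dist.2]; push_cast; ring

theorem tripleKernel_shrikhande {n : ℤ} {w x y : ZMod 4 × ZMod 4}
    (h : ∑ z : ZMod 4 × ZMod 4, (6 - 4 * (shrikhandeWeight (z + x - w) : ℤ)) *
      (6 - 4 * (shrikhandeWeight z : ℤ)) *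
      (6 - 4 * (shrikhandeWeight (z + x - y) : ℤ)) = 16 * n) :
    tripleKernel shrikhande 2 w x y = n := by
  simp only [tripleKernel, kernel_shrikhande]
  rw [← Equiv.sum_comp (Equiv.addRight x)]
  simp only [Equiv.coe_addRight, add_sub_cancel_right]
  have h' := congrArg (Int.cast : ℤ → ℝ) h
  push_cast at h' ⊢
  rw [h']
  ring

theorem tripleKernel_shrikhande_self (w x : ZMod 4 × ZMod 4) :
    tripleKernel shrikhande 2 w x x = 2 * kernel shrikhande 2 w x := by
  have h : ∀ v : ZMod 4 × ZMod 4, ∑ z : ZMod 4 × ZMod 4, (6 - 4 * (shrikhandeWeight (z + v) : ℤ)) *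
      (6 - 4 * (shrikhandeWeight z : ℤ)) *
      (6 - 4 * (shrikhandeWeight z : ℤ)) = 16 * (2 * (6 - 4 * (shrikhandeWeight v : ℤ))) := by
    decide
  rw [tripleKernel_shrikhande (n := 2 * (6 - 4 * (shrikhandeWeight (x - w) : ℤ))),
    kernel_shrikhande]
  · push_cast; ring
  · rw [← h (x - w)]
    exact Finset.sum_congr rfl fun z _ => by rw [add_sub_assoc, add_sub_cancel_right]

end Kernel

section Norton

variable {X : Type*} {Γ : SimpleGraph X} {ι : Type*} [Fintype ι] [DecidableEq ι] {V : ι → Type*} [∀ i, Fintype (V i)]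
  {G : ∀ i, SimpleGraph (V i)} {w : ι → ℕ}

theorem dist_eq_sum_of_iso (hG : ∀ i, IsHammingLike (G i) (w i)) (φ : Γ ≃g cartesianProduct G)
    (x y : X) : Γ.dist x y = ∑ i, (G i).dist (φ x i) (φ y i) := by
  have hc := connected_and_dist_cartesianProduct fun i => (hG i).connected
  rw [(connected_and_dist_iso hc.1 φ).2, hc.2]

theorem kernel_eq_sum_of_iso (hG : ∀ i, IsHammingLike (G i) (w i)) (φ : Γ ≃g cartesianProduct G)
    (x y : X) : kernel Γ (∑ i, w i) x y = ∑ i, kernel (G i) (w i) (φ x i) (φ y i) := by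
  simp only [kernel, dist_eq_sum_of_iso hG φ, Finset.sum_sub_distrib, Finset.mul_sum,
    Nat.cast_sum]

variable [Fintype X] [DecidableEq X]

theorem mulVec_hat_apply (E : Matrix X X ℝ) (x y : X) : (E *ᵥ hat x) y = E y x := by
  simp [hat]

theorem IsHammingLike.mulVec_hat_apply {D : ℕ} (hΓ : IsHammingLike Γ D) (x y : X) :
    (krawtchoukIdempotent Γ D 1 *ᵥ hat x) y = ((4 : ℝ) ^ D)⁻¹ * kernel Γ D y x := by
  rw [DRG.mulVec_hat_apply, krawtchoukIdempotent_apply, krawtchouk_one (hΓ.dist_le _ _), kernel]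

theorem norton_apply_of_iso (hG : ∀ i, IsHammingLike (G i) (w i)) (hw : ∀ i, 1 ≤ w i)
    (φ : Γ ≃g cartesianProduct G) (x y u : X) :
    norton (krawtchoukIdempotent Γ (∑ i, w i) 1)
      (krawtchoukIdempotent Γ (∑ i, w i) 1 *ᵥ hat x)
      (krawtchoukIdempotent Γ (∑ i, w i) 1 *ᵥ hat y) u =
    ((4 : ℝ) ^ ∑ i, w i)⁻¹ ^ 2 *
      ∑ i, tripleKernel (G i) (w i) (φ u i) (φ x i) (φ y i) := by
  have hΓ : IsHammingLike Γ (∑ i, w i) := (IsHammingLike.cartesianProduct hG).of_iso φ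
  have hne : ∀ i, Nonempty (V i) := fun i => (hG i).connected.nonempty
  have h1 := sum_mul_sum_mul_sum
    (p := fun i a => kernel (G i) (w i) (φ u i) a) (q := fun i a => kernel (G i) (w i) (φ x i) a)
    (r := fun i a => kernel (G i) (w i) (φ y i) a) (fun i => (hG i).sum_kernel (hw i) _)
    (fun i => (hG i).sum_kernel (hw i) _) (fun i => (hG i).sum_kernel (hw i) _)
  rw [← Equiv.sum_comp φ.toEquiv, (IsHammingLike.cartesianProduct hG).card_eq] at h1
  simp only [(hG _).card_eq] at h1
  simp only [RelIso.coe_fn_toEquiv, ← kernel_eq_sum_of_iso hG φ] at h1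
  have h2 : ∀ z, krawtchoukIdempotent Γ (∑ i, w i) 1 u z =
      ((4 : ℝ) ^ ∑ i, w i)⁻¹ * kernel Γ (∑ i, w i) u z := fun z => by
    rw [krawtchoukIdempotent_apply, krawtchouk_one (hΓ.dist_le _ _), kernel]
  have h3 : norton (krawtchoukIdempotent Γ (∑ i, w i) 1)
      (krawtchoukIdempotent Γ (∑ i, w i) 1 *ᵥ hat x)
      (krawtchoukIdempotent Γ (∑ i, w i) 1 *ᵥ hat y) u =
      ((4 : ℝ) ^ ∑ i, w i)⁻¹ ^ 3 * ∑ z, kernel Γ (∑ i, w i) u z * kernel Γ (∑ i, w i) x z *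
        kernel Γ (∑ i, w i) y z := by
    rw [norton, Matrix.mulVec, dotProduct, Finset.mul_sum]
    refine Finset.sum_congr rfl fun z _ => ?_
    rw [Pi.mul_apply, hΓ.mulVec_hat_apply, hΓ.mulVec_hat_apply, h2, kernel_comm _ _ z x,
      kernel_comm _ _ z y]
    ring
  rw [h3, h1]
  simp only [tripleKernel]
  push_cast
  field_simp

end Norton

section Doob

variable {X : Type*} [Fintype X] [DecidableEq X] {Γ : SimpleGraph X}
  {ι : Type*} [Fintype ι] [DecidableEq ι] {V : ι → Type*} [∀ i, Fintype (V i)]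
  {G : ∀ i, SimpleGraph (V i)} {w : ι → ℕ}

/-- Replacing one coordinate of a vertex `o` by two vertices of a Shrikhande factor at distance two
gives vertices whose common neighbours are found in the same factor. -/
theorem sphere_one_inter_sphere_one (hG : ∀ i, IsHammingLike (G i) (w i))
    (φ : Γ ≃g cartesianProduct G) (i₀ : ι) (ψ : G i₀ ≃g shrikhande) (o : ∀ i, V i) :
    sphere Γ 1 (φ.symm (Function.update o i₀ (ψ.symm (0, 0)))) ∩
      sphere Γ 1 (φ.symm (Function.update o i₀ (ψ.symm (1, 2)))) =
      {φ.symm (Function.update o i₀ (ψ.symm (0, 1))),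
        φ.symm (Function.update o i₀ (ψ.symm (1, 1)))} := by
  have hw : ∀ v : ZMod 4 × ZMod 4, shrikhandeWeight (v - (0, 0)) = 1 ∧
      shrikhandeWeight (v - (1, 2)) = 1 ↔ v = (0, 1) ∨ v = (1, 1) := by decide
  have hw2 : ∀ v : ZMod 4 × ZMod 4,
      2 ≤ shrikhandeWeight (v - (0, 0)) + shrikhandeWeight (v - (1, 2)) := by decide
  have hd : ∀ (z : ∀ i, V i) (q : ZMod 4 × ZMod 4),
      Γ.dist (φ.symm (Function.update o i₀ (ψ.symm q))) (φ.symm z) =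
        shrikhandeWeight (ψ (z i₀) - q) +
          ∑ i ∈ Finset.univ.erase i₀, (G i).dist (o i) (z i) := by
    intro z q
    rw [dist_eq_sum_of_iso hG, ← Finset.add_sum_erase _ _ (Finset.mem_univ i₀)]
    rw [RelIso.apply_symm_apply, RelIso.apply_symm_apply, Function.update_self]
    rw [(connected_and_dist_iso shrikhande_connected_and_dist.1 ψ).2,
      shrikhande_connected_and_dist.2, RelIso.apply_symm_apply]
    congr 1
    exact Finset.sum_congr rfl fun j hj => by
      rw [Function.update_of_ne (Finset.ne_of_mem_erase hj)]
  ext x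
  obtain ⟨z, rfl⟩ := φ.symm.surjective x
  simp only [sphere, Finset.mem_inter, Finset.mem_filter, Finset.mem_univ, true_and,
    Finset.mem_insert, Finset.mem_singleton, hd, EmbeddingLike.apply_eq_iff_eq]
  constructor
  · rintro ⟨h1, h2⟩
    have h3 := hw2 (ψ (z i₀))
    have h4 : ∑ i ∈ Finset.univ.erase i₀, (G i).dist (o i) (z i) = 0 := by omega
    have h5 : ∀ q, ψ (z i₀) = q → z = Function.update o i₀ (ψ.symm q) := by
      rintro q rfl
      ext i
      by_cases hi : i = i₀
      · subst hi; simp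
      · rw [Function.update_of_ne hi]
        rw [Finset.sum_eq_zero_iff] at h4
        exact ((hG i).connected.dist_eq_zero_iff.1 (h4 i (by simp [hi]))).symm
    exact ((hw _).1 ⟨by omega, by omega⟩).imp (h5 _) (h5 _)
  · intro h
    have h6 : ψ (z i₀) = (0, 1) ∨ ψ (z i₀) = (1, 1) := by
      rcases h with rfl | rfl <;> simp
    have h7 : ∑ i ∈ Finset.univ.erase i₀, (G i).dist (o i) (z i) = 0 := by
      refine Finset.sum_eq_zero fun i hi => ?_
      rcases h with rfl | rfl <;> simp [Function.update_of_ne (Finset.ne_of_mem_erase hi)]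
    rw [h7]
    exact (hw _).2 h6

theorem not_nortonBalancedSet_of_shrikhande_factor (hG : ∀ i, IsHammingLike (G i) (w i))
    (hw : ∀ i, 1 ≤ w i) (φ : Γ ≃g cartesianProduct G) {i₀ i₁ : ι} (hi : i₁ ≠ i₀)
    (h₀ : w i₀ = 2) (ψ : G i₀ ≃g shrikhande)
    (h₁ : ∀ a b, tripleKernel (G i₁) (w i₁) a b b = 2 * kernel (G i₁) (w i₁) a b) :
    ¬ NortonBalancedSet Γ (∑ i, w i) (krawtchoukIdempotent Γ (∑ i, w i) 1) := by
  intro hN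
  have hΓ : IsHammingLike Γ (∑ i, w i) := (IsHammingLike.cartesianProduct hG).of_iso φ
  have hne : ∀ i, Nonempty (V i) := fun i => (hG i).connected.nonempty
  obtain ⟨o⟩ : Nonempty (∀ i, V i) := inferInstance
  have hD : 1 ≤ ∑ i, w i :=
    (hw i₀).trans (Finset.single_le_sum (f := w) (fun _ _ => Nat.zero_le _) (Finset.mem_univ i₀))
  let pt : ZMod 4 × ZMod 4 → ∀ i, V i := fun q => Function.update o i₀ (ψ.symm q)
  have hpt : ∀ q, pt q i₀ = ψ.symm q := fun q => Function.update_self ..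
  have hpt' : ∀ q, pt q i₁ = o i₁ := fun q => Function.update_of_ne hi ..
  have h := hN (φ.symm (pt (0, 0))) (φ.symm (pt (1, 2))) 1 1 hD hD
  rw [sphere_one_inter_sphere_one hG φ i₀ ψ o, Finset.sum_pair, Submodule.mem_span_triple] at h
  swap
  · intro h
    have := congrArg ψ (congrFun (φ.symm.injective h) i₀)
    simp at this
    exact absurd this (by decide)
  obtain ⟨a, b, c, h⟩ := h
  set C : ℝ := ((4 : ℝ) ^ ∑ i, w i)⁻¹ with hC
  have hC0 : C ≠ 0 := by positivity
  let f : ∀ i, V i → ℝ := fun i v => kernel (G i) (w i) v (pt (0, 1) i) +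
      kernel (G i) (w i) v (pt (1, 1) i) - a * kernel (G i) (w i) v (pt (0, 0) i) -
      b * kernel (G i) (w i) v (pt (1, 2) i) -
      c * C * tripleKernel (G i) (w i) v (pt (0, 0) i) (pt (1, 2) i)
  have key : ∀ u : ∀ i, V i, ∑ i, f i (u i) = 0 := by
    intro u
    have hu := congrFun h (φ.symm u)
    simp only [Pi.add_apply, Pi.smul_apply, smul_eq_mul, hΓ.mulVec_hat_apply,
      norton_apply_of_iso hG hw φ, kernel_eq_sum_of_iso hG φ, RelIso.apply_symm_apply] at hu
    rw [← hC] at hu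
    simp only [f, Finset.sum_add_distrib, Finset.sum_sub_distrib, ← Finset.mul_sum]
    refine mul_left_cancel₀ hC0 ?_
    linear_combination -hu
  have e₁ := fun p => eq_of_forall_sum_eq_zero key o i₁ p
  have e₀ := fun p q => (eq_of_forall_sum_eq_zero key o i₀ (ψ.symm p)).trans
    (eq_of_forall_sum_eq_zero key o i₀ (ψ.symm q)).symm
  simp only [f, hpt', h₁] at e₁
  have hc := shrikhande_connected_and_dist.1
  simp only [f, hpt, h₀, kernel_iso hc ψ, tripleKernel_iso hc ψ, RelIso.apply_symm_apply,
    kernel_shrikhande] at e₀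
  have t1 : tripleKernel shrikhande 2 (0, 0) (0, 0) (1, 2) = (-4 : ℤ) :=
    tripleKernel_shrikhande (by decide)
  have t2 : tripleKernel shrikhande 2 (1, 2) (0, 0) (1, 2) = (-4 : ℤ) :=
    tripleKernel_shrikhande (by decide)
  have t3 : tripleKernel shrikhande 2 (0, 1) (0, 0) (1, 2) = (0 : ℤ) :=
    tripleKernel_shrikhande (by decide)
  have t4 : tripleKernel shrikhande 2 (1, 0) (0, 0) (1, 2) = (0 : ℤ) :=
    tripleKernel_shrikhande (by decide)
  have e2 : ((2 : ℤ) : ℝ) + ((2 : ℤ) : ℝ) - a * ((-2 : ℤ) : ℝ) - b * ((6 : ℤ) : ℝ) -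
      c * C * tripleKernel shrikhande 2 (1, 2) (0, 0) (1, 2) =
      ((2 : ℤ) : ℝ) + ((2 : ℤ) : ℝ) - a * ((6 : ℤ) : ℝ) - b * ((-2 : ℤ) : ℝ) -
      c * C * tripleKernel shrikhande 2 (0, 0) (0, 0) (1, 2) := e₀ (1, 2) (0, 0)
  have e3 : ((6 : ℤ) : ℝ) + ((2 : ℤ) : ℝ) - a * ((2 : ℤ) : ℝ) - b * ((2 : ℤ) : ℝ) -
      c * C * tripleKernel shrikhande 2 (0, 1) (0, 0) (1, 2) =
      ((2 : ℤ) : ℝ) + ((2 : ℤ) : ℝ) - a * ((6 : ℤ) : ℝ) - b * ((-2 : ℤ) : ℝ) -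
      c * C * tripleKernel shrikhande 2 (0, 0) (0, 0) (1, 2) := e₀ (0, 1) (0, 0)
  have e4 : ((-2 : ℤ) : ℝ) + ((2 : ℤ) : ℝ) - a * ((2 : ℤ) : ℝ) - b * ((-2 : ℤ) : ℝ) -
      c * C * tripleKernel shrikhande 2 (1, 0) (0, 0) (1, 2) =
      ((2 : ℤ) : ℝ) + ((2 : ℤ) : ℝ) - a * ((6 : ℤ) : ℝ) - b * ((-2 : ℤ) : ℝ) -
      c * C * tripleKernel shrikhande 2 (0, 0) (0, 0) (1, 2) := e₀ (1, 0) (0, 0)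
  rw [t1, t2] at e2
  rw [t1, t3] at e3
  rw [t1, t4] at e4
  norm_num at e2 e3 e4
  obtain ⟨p, hp⟩ : ∃ p, kernel (G i₁) (w i₁) p (o i₁) ≠ kernel (G i₁) (w i₁) (o i₁) (o i₁) := by
    by_contra! hk
    have hs := (hG i₁).sum_kernel (hw i₁) (o i₁)
    simp only [kernel_comm _ _ (o i₁), hk, Finset.sum_const, Finset.card_univ, nsmul_eq_mul,
      mul_eq_zero, Nat.cast_eq_zero, Fintype.card_ne_zero, false_or] at hs
    simp only [kernel, SimpleGraph.dist_self, Nat.cast_zero, mul_zero, sub_zero, mul_eq_zero,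
      Nat.cast_eq_zero] at hs
    have := hw i₁
    norm_num at hs
    omega
  have e5 := e₁ p
  have e6 : (2 - a - b - 2 * (c * C)) *
      (kernel (G i₁) (w i₁) p (o i₁) - kernel (G i₁) (w i₁) (o i₁) (o i₁)) = 0 := by
    linear_combination e5
  have e7 := (mul_eq_zero.1 e6).resolve_right (sub_ne_zero.2 hp)
  linarith

end Doob

section Hamming

variable {D : ℕ}

/-- The contribution of one coordinate to the generating function of the distances from two
vertices of `H(D,4)`. -/
def coordWeight (s t : ℝ) (p v q : Fin 4) : ℝ :=
  s ^ (if p = v then 0 else 1) * t ^ (if v = q then 0 else 1)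

theorem sum_coordWeight (s t : ℝ) (p q : Fin 4) :
    ∑ v, coordWeight s t p v q = if p = q then 1 + 3 * (s * t) else s + t + 2 * (s * t) := by
  simp only [coordWeight, Fin.sum_univ_four]
  fin_cases p <;> fin_cases q <;> simp <;> ring

theorem pow_dist_mul_pow_dist (s t : ℝ) (x y z : Fin D → Fin 4) :
    s ^ (hamming D 4).dist x z * t ^ (hamming D 4).dist z y =
      ∏ c, coordWeight s t (x c) (z c) (y c) := by
  have h : ∀ x y : Fin D → Fin 4, (hamming D 4).dist x y = ∑ c, if x c = y c then 0 else 1 := by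
    intro x y
    rw [hamming_dist, hammingDist]
    simp [Finset.sum_ite]
  rw [h, h, ← Finset.prod_pow_eq_pow_sum, ← Finset.prod_pow_eq_pow_sum, ← Finset.prod_mul_distrib]
  rfl

theorem sum_coordWeight_mul_sum_filter (s t : ℝ) (x y : Fin D → Fin 4) (c : Fin D) (a : Fin 4) :
    (∑ v, coordWeight s t (x c) v (y c)) *
      ∑ z ∈ Finset.univ.filter fun z : Fin D → Fin 4 => z c = a,
        s ^ (hamming D 4).dist x z * t ^ (hamming D 4).dist z y =
    coordWeight s t (x c) a (y c) * ∏ c, ∑ v, coordWeight s t (x c) v (y c) := by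
  have h : ∑ z ∈ Finset.univ.filter fun z : Fin D → Fin 4 => z c = a,
      s ^ (hamming D 4).dist x z * t ^ (hamming D 4).dist z y =
      ∏ c', ∑ v, if c' = c ∧ v ≠ a then 0 else coordWeight s t (x c') v (y c') := by
    rw [Finset.prod_univ_sum, Fintype.piFinset_univ, Finset.sum_filter]
    refine Finset.sum_congr rfl fun z _ => ?_
    split_ifs with hz
    · rw [pow_dist_mul_pow_dist]
      refine Finset.prod_congr rfl fun c' _ => ?_
      rw [if_neg]
      rintro ⟨rfl, h⟩
      exact h hz
    · symm
      apply Finset.prod_eq_zero (Finset.mem_univ c)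
      exact if_pos ⟨rfl, hz⟩
  rw [h, ← Finset.mul_prod_erase _ _ (Finset.mem_univ c),
    ← Finset.mul_prod_erase (a := c) _ (fun c => ∑ v, coordWeight s t (x c) v (y c))
      (Finset.mem_univ c)]
  rw [Finset.prod_congr rfl (g := fun c => ∑ v, coordWeight s t (x c) v (y c))
    fun c' hc' => by simp [Finset.ne_of_mem_erase hc']]
  have h2 : (∑ v, if c = c ∧ v ≠ a then 0 else coordWeight s t (x c) v (y c)) =
      coordWeight s t (x c) a (y c) := by
    rw [Finset.sum_eq_single a]
    · simp
    · intro v _ hv; simp [hv]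
    · simp
  rw [h2]
  ring

/-- The number of vertices at given distances from `x` and `y` with a given coordinate only depends
on which of this coordinate and the corresponding ones of `x` and `y` are equal. -/
theorem card_filter_coord_eq {i j : ℕ} (hi : i ≤ D) (hj : j ≤ D) (x y : Fin D → Fin 4)
    {c c' : Fin D} {a a' : Fin 4} (h1 : x c = y c ↔ x c' = y c') (h2 : a = x c ↔ a' = x c')
    (h3 : a = y c ↔ a' = y c') :
    ((sphere (hamming D 4) i x ∩ sphere (hamming D 4) j y).filter fun z => z c = a).card =
      ((sphere (hamming D 4) i x ∩ sphere (hamming D 4) j y).filter fun z => z c' = a').card := by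
  have hH := isHammingLike_hamming D
  have hN : ∀ c a, (sphere (hamming D 4) i x ∩ sphere (hamming D 4) j y).filter
      (fun z => z c = a) = (Finset.univ.filter fun z => z c = a).filter
        fun z => (hamming D 4).dist x z = i ∧ (hamming D 4).dist z y = j := by
    intro c a
    ext z
    simp only [sphere, Finset.mem_filter, Finset.mem_inter, Finset.mem_univ, true_and,
      SimpleGraph.dist_comm (u := z)]
    tauto
  have hS : ∀ p q s t, 0 < s → 0 < t → 0 < ∑ v, coordWeight s t p v q := fun p q s t hs ht => by
    rw [sum_coordWeight]; split_ifs <;> positivity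
  rw [hN, hN]
  have := coeff_eq_of_forall_pos₂ (n := D + 1)
    (c := fun i j => (((Finset.univ.filter fun z : Fin D → Fin 4 => z c = a).filter
      fun z => (hamming D 4).dist x z = i ∧ (hamming D 4).dist z y = j).card : ℝ))
    (c' := fun i j => (((Finset.univ.filter fun z : Fin D → Fin 4 => z c' = a').filter
      fun z => (hamming D 4).dist x z = i ∧ (hamming D 4).dist z y = j).card : ℝ))
    (fun s t hs ht => by
      rw [← sum_eq_sum_card_mul _ D _ _ (hH.dist_le x) (fun z => hH.dist_le z y)
        (fun i j => s ^ i * t ^ j), ← sum_eq_sum_card_mul _ D _ _ (hH.dist_le x)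
        (fun z => hH.dist_le z y) (fun i j => s ^ i * t ^ j)]
      refine mul_left_cancel₀ (hS (x c) (y c) s t hs ht).ne' ?_
      rw [sum_coordWeight_mul_sum_filter]
      have h4 : ∑ v, coordWeight s t (x c) v (y c) = ∑ v, coordWeight s t (x c') v (y c') := by
        simp only [sum_coordWeight, h1]
      have h5 : coordWeight s t (x c) a (y c) = coordWeight s t (x c') a' (y c') := by
        simp only [coordWeight, eq_comm (b := a), eq_comm (b := a'), h2, h3]
      rw [h4, h5, sum_coordWeight_mul_sum_filter])
    i (by simp; omega) j (by simp; omega)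
  exact_mod_cast this

/-- Summing a function of one coordinate, with values in the eigenspace of a factor. -/
theorem sum_pattern_mul_kernel (n : Bool × Bool × Bool → ℝ) (p q v : Fin 4) :
    ∑ a, n (decide (p = q), decide (a = p), decide (a = q)) *
      kernel (⊤ : SimpleGraph (Fin 4)) 1 v a =
    if p = q then (n (true, true, true) - n (true, false, false)) *
      kernel (⊤ : SimpleGraph (Fin 4)) 1 v p
    else (n (false, true, false) - n (false, false, false)) *
        kernel (⊤ : SimpleGraph (Fin 4)) 1 v p +
      (n (false, false, true) - n (false, false, false)) *
        kernel (⊤ : SimpleGraph (Fin 4)) 1 v q := by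
  simp only [kernel_top, Fin.sum_univ_four]
  fin_cases p <;> fin_cases q <;> fin_cases v <;> simp <;> ring

theorem nortonBalancedSet_hamming (D : ℕ) :
    NortonBalancedSet (hamming D 4) D (krawtchoukIdempotent (hamming D 4) D 1) := by
  intro x y i j hi hj
  let φ : hamming D 4 ≃g cartesianProduct fun _ : Fin D => (⊤ : SimpleGraph (Fin 4)) :=
    ⟨Equiv.refl _, by rw [hamming_eq_cartesianProduct]; rfl⟩
  have hsum : ∑ _i : Fin D, 1 = D := by simp
  have hker : ∀ u z, kernel (hamming D 4) D u z =
      ∑ c, kernel (⊤ : SimpleGraph (Fin 4)) 1 (u c) (z c) := by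
    intro u z
    have := kernel_eq_sum_of_iso (fun _ => isHammingLike_top) φ u z
    rwa [hsum] at this
  have hnor : ∀ u, norton (krawtchoukIdempotent (hamming D 4) D 1)
      (krawtchoukIdempotent (hamming D 4) D 1 *ᵥ hat x)
      (krawtchoukIdempotent (hamming D 4) D 1 *ᵥ hat y) u = ((4 : ℝ) ^ D)⁻¹ ^ 2 *
        ∑ c, tripleKernel (⊤ : SimpleGraph (Fin 4)) 1 (u c) (x c) (y c) := by
    intro u
    have := norton_apply_of_iso (fun _ => isHammingLike_top) (fun _ => le_rfl) φ x y u
    rwa [hsum] at this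
  let N : Fin D × Fin 4 → ℝ := fun p =>
    ((sphere (hamming D 4) i x ∩ sphere (hamming D 4) j y).filter fun z => z p.1 = p.2).card
  let pat : Fin D × Fin 4 → Bool × Bool × Bool := fun p =>
    (decide (x p.1 = y p.1), decide (p.2 = x p.1), decide (p.2 = y p.1))
  obtain ⟨n, hn⟩ : ∃ n : Bool × Bool × Bool → ℝ, N = n ∘ pat := by
    rw [← Function.factorsThrough_iff]
    intro p q hpq
    simp only [pat, Prod.mk.injEq, decide_eq_decide] at hpq
    simp only [N, Nat.cast_inj]
    exact card_filter_coord_eq hi hj x y hpq.1 hpq.2.1 hpq.2.2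
  have hS : ∀ u : Fin D → Fin 4, ∑ z ∈ sphere (hamming D 4) i x ∩ sphere (hamming D 4) j y,
      kernel (hamming D 4) D u z = ∑ c, ∑ a,
        n (decide (x c = y c), decide (a = x c), decide (a = y c)) *
          kernel (⊤ : SimpleGraph (Fin 4)) 1 (u c) a := by
    intro u
    simp only [hker]
    rw [Finset.sum_comm]
    refine Finset.sum_congr rfl fun c _ => ?_
    rw [← Finset.sum_fiberwise _ fun z => z c]
    refine Finset.sum_congr rfl fun a _ => ?_
    have h1 : N (c, a) = n (pat (c, a)) := congrFun hn (c, a)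
    rw [← show n (pat (c, a)) = n (decide (x c = y c), decide (a = x c), decide (a = y c)) from rfl,
      ← h1, ← nsmul_eq_mul, ← Finset.sum_const]
    exact Finset.sum_congr rfl fun z hz => by rw [(Finset.mem_filter.1 hz).2]
  simp only [sum_pattern_mul_kernel] at hS
  generalize n (true, true, true) - n (true, false, false) = α at hS
  generalize n (false, true, false) - n (false, false, false) = β at hS
  generalize n (false, false, true) - n (false, false, false) = γ at hS
  rw [Submodule.mem_span_triple]
  refine ⟨β + (α - β - γ) / 4, γ + (α - β - γ) / 4, (α - β - γ) / 4 * 4 ^ D, ?_⟩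
  ext u
  simp only [Pi.add_apply, Pi.smul_apply, Finset.sum_apply, smul_eq_mul,
    (isHammingLike_hamming D).mulVec_hat_apply, hnor, ← Finset.mul_sum, hS]
  rw [hker, hker]
  have h4 : (4 : ℝ) ^ D ≠ 0 := by positivity
  have hc : ∀ c, (if x c = y c then α * kernel (⊤ : SimpleGraph (Fin 4)) 1 (u c) (x c)
      else β * kernel (⊤ : SimpleGraph (Fin 4)) 1 (u c) (x c) +
        γ * kernel (⊤ : SimpleGraph (Fin 4)) 1 (u c) (y c)) =
      (β + (α - β - γ) / 4) * kernel (⊤ : SimpleGraph (Fin 4)) 1 (u c) (x c) +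
      (γ + (α - β - γ) / 4) * kernel (⊤ : SimpleGraph (Fin 4)) 1 (u c) (y c) +
      (α - β - γ) / 4 * tripleKernel (⊤ : SimpleGraph (Fin 4)) 1 (u c) (x c) (y c) := by
    intro c
    rw [tripleKernel_top]
    split_ifs with h
    · rw [h]; ring
    · ring
  simp only [hc, Finset.sum_add_distrib, ← Finset.mul_sum]
  field_simp

end Hamming

section Main

theorem IsHammingLike.nortonBalancedSet_iff {X : Type*} [Fintype X] [DecidableEq X]
    {Γ : SimpleGraph X} {D : ℕ} (hΓ : IsHammingLike Γ D) (hD : 3 ≤ D) :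
    IsNortonBalanced Γ D ↔ NortonBalancedSet Γ D (krawtchoukIdempotent Γ D 1) := by
  constructor
  · rintro ⟨_, ⟨F, hF, i, hi, rfl⟩, h⟩
    rwa [hΓ.eq_krawtchoukIdempotent_one hD hF hi] at h
  · intro h
    exact ⟨_, ⟨_, (hΓ.isStandardOrdering (by omega)).1, ⟨1, by omega⟩, rfl, rfl⟩, h⟩

theorem fin_val_one_of_le {D : ℕ} (hD : 3 ≤ D) : ((1 : Fin (D + 1)) : ℕ) = 1 := by
  rw [Fin.val_one', Nat.mod_eq_of_lt (by omega)]

theorem IsDoob.isHammingLike_and_not_nortonBalancedSet {X : Type*} [Fintype X] [DecidableEq X]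
    {Γ : SimpleGraph X} {D : ℕ} (h : IsDoob Γ) (hdiam : Γ.diam = D) (hD : 3 ≤ D) :
    IsHammingLike Γ D ∧ ¬ NortonBalancedSet Γ D (krawtchoukIdempotent Γ D 1) := by
  obtain ⟨r, V, G, hG, ⟨i₀, ⟨ψ⟩⟩, ⟨φ⟩⟩ := h
  have hfin : ∀ i, Finite (V i) := fun i => by
    rcases hG i with ⟨⟨e⟩⟩ | ⟨⟨e⟩⟩
    · exact Finite.of_equiv _ e.toEquiv.symm
    · exact Finite.of_equiv _ e.toEquiv.symm
  let _ : ∀ i, Fintype (V i) := fun i => Fintype.ofFinite _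
  have hw : ∀ i, ∃ w, IsHammingLike (G i) w ∧ 1 ≤ w ∧
      (∀ a b, tripleKernel (G i) w a b b = 2 * kernel (G i) w a b) ∧
      (Nonempty (G i ≃g shrikhande) → w = 2) := by
    intro i
    by_cases hs : Nonempty (G i ≃g shrikhande)
    · obtain ⟨e⟩ := hs
      refine ⟨2, isHammingLike_shrikhande.of_iso e, by omega, fun a b => ?_, fun _ => rfl⟩
      rw [tripleKernel_iso isHammingLike_shrikhande.connected e,
        kernel_iso isHammingLike_shrikhande.connected e, tripleKernel_shrikhande_self]
    · obtain ⟨e⟩ := (hG i).resolve_left hs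
      refine ⟨1, isHammingLike_top.of_iso e, le_rfl, fun a b => ?_, fun h => absurd h hs⟩
      rw [tripleKernel_iso isHammingLike_top.connected e,
        kernel_iso isHammingLike_top.connected e, tripleKernel_top, if_pos rfl]
  choose w hw hw1 hwt hw2 using hw
  have hΓ := (IsHammingLike.cartesianProduct hw).of_iso φ
  obtain rfl : ∑ i, w i = D := hΓ.diam_eq.symm.trans hdiam
  refine ⟨hΓ, ?_⟩
  obtain ⟨i₁, hi₁⟩ : ∃ i₁, i₁ ≠ i₀ := by
    by_contra! hall
    rw [Finset.sum_eq_single i₀ (fun i _ hi => absurd (hall i) hi) (by simp), hw2 i₀ ⟨ψ⟩] at hD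
    omega
  exact not_nortonBalancedSet_of_shrikhande_factor hw hw1 φ hi₁ (hw2 i₀ ⟨ψ⟩) ψ (hwt i₁)

/-- There are Doob graphs of every diameter `D ≥ 2`. -/
theorem exists_isDoob (n : ℕ) : ∃ (X : Type) (_ : Fintype X) (_ : DecidableEq X)
    (Γ : SimpleGraph X), IsDoob Γ ∧ Γ.diam = n + 2 := by
  classical
  let V : Fin (n + 1) → Type := Fin.cons (ZMod 4 × ZMod 4) fun _ => Fin 4
  let inst : ∀ i, Fintype (V i) :=
    Fin.cases (motive := fun i => Fintype (V i)) (inferInstance : Fintype (ZMod 4 × ZMod 4))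
      fun _ => (inferInstance : Fintype (Fin 4))
  let G : ∀ i, SimpleGraph (V i) :=
    Fin.cases (motive := fun i => SimpleGraph (V i)) shrikhande
      fun _ => (⊤ : SimpleGraph (Fin 4))
  let w : Fin (n + 1) → ℕ := Fin.cases 2 fun _ => 1
  have hG : ∀ i, IsHammingLike (G i) (w i) := by
    intro i
    induction i using Fin.cases with
    | zero => exact isHammingLike_shrikhande
    | succ i => exact isHammingLike_top
  refine ⟨∀ i, V i, inferInstance, inferInstance, cartesianProduct G,
    ⟨n + 1, V, G, fun i => ?_, ⟨0, ⟨SimpleGraph.Iso.refl⟩⟩, ⟨SimpleGraph.Iso.refl⟩⟩, ?_⟩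
  · induction i using Fin.cases with
    | zero => exact Or.inl ⟨SimpleGraph.Iso.refl⟩
    | succ i => exact Or.inr ⟨SimpleGraph.Iso.refl⟩
  · rw [(IsHammingLike.cartesianProduct hG).diam_eq, Fin.sum_univ_succ]
    simp [w, add_comm]

end Main
end DRG

theorem mainTheorem10 :
    (∀ (X : Type*) [Fintype X] [DecidableEq X] (Γ : SimpleGraph X) (D : ℕ),
      DRG.IsDoob Γ → Γ.diam = D → 3 ≤ D →
        (∃ p, DRG.HasIntersectionNumbers Γ D p ∧
          DRG.HasIntersectionNumbers (DRG.hamming D 4) D p) ∧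
        (∃ E : Fin (D + 1) → Matrix X X ℝ, DRG.IsStandardOrdering Γ E) ∧
        (∀ E : Fin (D + 1) → Matrix X X ℝ, DRG.IsStandardOrdering Γ E →
          ¬ DRG.NortonBalancedSet Γ D (E 1)) ∧
        ¬ DRG.IsNortonBalanced Γ D) ∧
    (∀ D : ℕ, 3 ≤ D →
      (∃ E : Fin (D + 1) → Matrix (Fin D → Fin 4) (Fin D → Fin 4) ℝ,
        DRG.IsStandardOrdering (DRG.hamming D 4) E) ∧
      (∀ E : Fin (D + 1) → Matrix (Fin D → Fin 4) (Fin D → Fin 4) ℝ,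
        DRG.IsStandardOrdering (DRG.hamming D 4) E →
          DRG.NortonBalancedSet (DRG.hamming D 4) D (E 1)) ∧
      DRG.IsNortonBalanced (DRG.hamming D 4) D) ∧
    (∀ D : ℕ, 3 ≤ D →
      ¬ ∃ P : (ℕ → ℕ → ℕ → ℕ) → Prop,
        ∀ (X : Type) [Fintype X] [DecidableEq X] (Γ : SimpleGraph X) (p : ℕ → ℕ → ℕ → ℕ),
          DRG.HasIntersectionNumbers Γ D p →
          (∃ E : Fin (D + 1) → Matrix X X ℝ, DRG.IsQPolynomialOrdering Γ E) →
            (DRG.IsNortonBalanced Γ D ↔ P p)) := by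
  refine ⟨fun X _ _ Γ D hdoob hdiam hD => ?_, fun D hD => ?_, fun D hD => ?_⟩
  · obtain ⟨hΓ, hN⟩ := hdoob.isHammingLike_and_not_nortonBalancedSet hdiam hD
    refine ⟨⟨_, hΓ.hasIntersectionNumbers, (DRG.isHammingLike_hamming D).hasIntersectionNumbers⟩,
      ⟨_, hΓ.isStandardOrdering (by omega)⟩, fun E hE => ?_, ?_⟩
    · rwa [hΓ.eq_krawtchoukIdempotent_one hD hE.1 (DRG.fin_val_one_of_le hD)]
    · rwa [hΓ.nortonBalancedSet_iff hD]
  · have hH := DRG.isHammingLike_hamming D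
    have hN := DRG.nortonBalancedSet_hamming D
    refine ⟨⟨_, hH.isStandardOrdering (by omega)⟩, fun E hE => ?_, ?_⟩
    · rwa [hH.eq_krawtchoukIdempotent_one hD hE.1 (DRG.fin_val_one_of_le hD)]
    · rwa [hH.nortonBalancedSet_iff hD]
  · rintro ⟨P, hP⟩
    obtain ⟨n, rfl⟩ := Nat.exists_eq_add_of_le' (show 2 ≤ D by omega)
    obtain ⟨X, _, _, Γ, hdoob, hdiam⟩ := DRG.exists_isDoob n
    obtain ⟨hΓ, hN⟩ := hdoob.isHammingLike_and_not_nortonBalancedSet hdiam hD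
    have hH := DRG.isHammingLike_hamming (n + 2)
    have h1 := hP X Γ _ hΓ.hasIntersectionNumbers ⟨_, (hΓ.isStandardOrdering (by omega)).1⟩
    have h2 := hP _ _ _ hH.hasIntersectionNumbers ⟨_, (hH.isStandardOrdering (by omega)).1⟩
    rw [hΓ.nortonBalancedSet_iff hD] at h1
    rw [hH.nortonBalancedSet_iff hD] at h2
    exact hN (h1.2 (h2.1 (DRG.nortonBalancedSet_hamming _)))
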